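/- **Model.** Firms 1 and 2 are located at $z_1,z_2\in[0,1]$ with $z_1<z_2$, produce at zero cost and simultaneously choose prices $p_1,p_2\ge 0$. A consumer with ideal point $t$ obtains utility $1-(p_i+|t-z_i|)$ from buying one unit from Firm $i$, and $0$ from not buying. There are three unit masses of consumers: captive buyers of Firm 1 at $0$ and captive buyers of Firm 2 at $1$, who buy from their own firm if and only if this gives nonnegative utility, and informed consumers, uniformly distributed on $(0,1)$, who buy from the firm with the higher utility if that utility is nonnegative (indifference between the firms is split equally). The profit of Firm $i$ is $p_i$ times its demand. A mixed strategy is a probability distribution on $[0,\infty)$, and a mixed price equilibrium is a Nash equilibrium in mixed strategies with expected profit as payoff. **Notation.** Let $\delta=z_2-z_1$, $\lambda_2=\frac1{2(1-z_2)}$, and $\mathrm{Ei}(x)=\int_{-\infty}^x \frac{e^t}{t}\,dt$ (Cauchy principal value for $x>0$). Put $$g_0(p;b)=1+\frac{2}{3-z_1-2z_2-b}e^{-\lambda_2(b-p)},$$ $$g_\pi(p;b)=\frac{2\lambda_2}{p+\delta}-\frac{2\lambda_2}{b+\delta}\,\frac{1-z_1-b}{3-z_1-2z_2-b}\,e^{-\lambda_2(b-p)}-2\lambda_2^2e^{\lambda_2(p+\delta)}\bigl(\mathrm{Ei}(-\lambda_2(b+\delta))-\mathrm{Ei}(-\lambda_2(p+\delta))\bigr),$$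 $$g(p;b,\pi)=g_0(p;b)-\pi\,g_\pi(p;b),$$ $$h(p;a)=4\lambda_2e^{-\lambda_2(p-a)}-\frac{4\lambda_2(a-\delta)}{p-\delta}+4\lambda_2^2(a-\delta)e^{-\lambda_2(p-\delta)}\bigl(\mathrm{Ei}(\lambda_2(p-\delta))-\mathrm{Ei}(\lambda_2(a-\delta))\bigr).$$ **Proposition.** Let $\tfrac12\le z_1<z_2\le 1$ and $(1-2z_1+z_2)(2-z_2)>z_2$. Let $w$ with $0<w<1-z_1$ satisfy $$h(1-2z_1+z_2;\,1-2z_1+z_2-w)=1,$$ put $\pi_1^\star=2(1-z_1-w)$ and $\pi_2^\star=\dfrac{g_0(1-z_1-w;1-z_1)}{g_\pi(1-z_1-w;1-z_1)}$, and suppose that $$z_1-(1-z_2)(z_2-z_1)+\frac{(1-z_2)w}{2}\ \ge\ \Bigl(\frac{z_1}{1-2z_1+z_2}+\frac{1-z_2}{1-2z_1+z_2-w}-1\Bigr)\pi_2^\star ,\qquad \pi_2^\star\ge z_2 .$$ Then the functions $$F_1^\star(p)=\begin{cases}0,&p<1-z_1-w,\\ g(p;1-z_1,\pi_2^\star),&1-z_1-w\le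 p<1-z_1,\\ 1,&p\ge 1-z_1,\end{cases}$$ $$F_2^\star(p)=\begin{cases}0,&p<1-2z_1+z_2-w,\\ h(p;1-2z_1+z_2-w),&1-2z_1+z_2-w\le p<1-2z_1+z_2,\\ 1,&p\ge 1-2z_1+z_2,\end{cases}$$ are the cumulative distribution functions of mixed strategies of Firms 1 and 2 that form a mixed price equilibrium (no deviation to any other mixed strategy is profitable for either firm), with expected profits $\pi_1^\star$ and $\pi_2^\star$. The support of Firm 1's strategy is $[1-z_1-w,\,1-z_1]$, and it has an atom at $1-z_1$; the support of Firm 2's strategy is $[1-2z_1+z_2-w,\,1-2z_1+z_2]$, and it has no atoms. Firm 2's price ceiling satisfies $1-2z_1+z_2\le z_2$, with strict inequality if $z_1>\tfrac12$. -/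

import Mathlib

noncomputable section

namespace SpatialCompetition

open Real Set Filter Topology MeasureTheory

/-- The exponential integral `Ei z = ∫_{-∞}^z exp t / t dt` for `z ≠ 0`, as a Cauchy principal
value when `z > 0`: there the two halves of `[-z, z]` are paired by the symmetry `t ↦ -t`.
That this is the principal value is proved in `tendsto_Ei`. -/
def Ei (z : ℝ) : ℝ :=
  (∫ t in Iic (-|z|), exp t / t) + ∫ t in (0 : ℝ)..(max z 0), (exp t - exp (-t)) / t

/-! ### The market -/

/-- Utility of a consumer with ideal point `t` who buys at price `p` from a firm located at `z`
(reservation value `1`, linear transportation cost). -/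
def utility (z p t : ℝ) : ℝ := 1 - (p + |t - z|)

/-- Probability with which an informed consumer buys from a firm offering utility `u`, if the other
firm offers `u'` and not buying gives `0`; indifference between the two firms is split equally. -/
def share (u u' : ℝ) : ℝ := if u < 0 ∨ u < u' then 0 else if u = u' then 1 / 2 else 1

/-- Demand, at price `p` of a firm at `z`, of the unit mass of this firm's captive buyers located
at `e`. -/
def captiveDemand (e z p : ℝ) : ℝ := if 0 ≤ utility z p e then 1 else 0

/-- Demand of the informed consumers, uniformly distributed on the unit interval, for the firm at
`z` with price `p`, if the other firm is at `z'` with price `p'`. -/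
def informedDemand (z p z' p' : ℝ) : ℝ :=
  ∫ t in Ioo (0 : ℝ) 1, share (utility z p t) (utility z' p' t)

/-- Profit of a firm at `z` with price `p` and captive buyers at `e` against a firm at `z'` with
price `p'`. -/
def profit (e z p z' p' : ℝ) : ℝ := p * (captiveDemand e z p + informedDemand z p z' p')

/-- Profit of Firm 1, whose captive buyers are at `0`. -/
def profit₁ (z₁ z₂ p₁ p₂ : ℝ) : ℝ := profit 0 z₁ p₁ z₂ p₂

/-- Profit of Firm 2, whose captive buyers are at `1`. -/
def profit₂ (z₁ z₂ p₁ p₂ : ℝ) : ℝ := profit 1 z₂ p₂ z₁ p₁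

/-! ### Mixed price equilibria -/

/-- A mixed strategy: a probability distribution of nonnegative prices. -/
def IsMixedStrategy (μ : Measure ℝ) : Prop := IsProbabilityMeasure μ ∧ μ (Iio 0) = 0

def expectedProfit₁ (z₁ z₂ : ℝ) (μ₁ μ₂ : Measure ℝ) : ℝ :=
  ∫ p, profit₁ z₁ z₂ p.1 p.2 ∂(μ₁.prod μ₂)

def expectedProfit₂ (z₁ z₂ : ℝ) (μ₁ μ₂ : Measure ℝ) : ℝ :=
  ∫ p, profit₂ z₁ z₂ p.1 p.2 ∂(μ₁.prod μ₂)

/-- `(μ₁, μ₂)` is a (mixed) Nash equilibrium of the price game at the locations `(z₁, z₂)`. -/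
structure IsPriceEquilibrium (z₁ z₂ : ℝ) (μ₁ μ₂ : Measure ℝ) : Prop where
  strategy₁ : IsMixedStrategy μ₁
  strategy₂ : IsMixedStrategy μ₂
  best₁ : ∀ ν, IsMixedStrategy ν → expectedProfit₁ z₁ z₂ ν μ₂ ≤ expectedProfit₁ z₁ z₂ μ₁ μ₂
  best₂ : ∀ ν, IsMixedStrategy ν → expectedProfit₂ z₁ z₂ μ₁ ν ≤ expectedProfit₂ z₁ z₂ μ₁ μ₂

/-! ### The explicit strategies -/

def lam₂ (z₂ : ℝ) : ℝ := 1 / (2 * (1 - z₂))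

def g₀ (z₁ z₂ p b : ℝ) : ℝ :=
  1 + 2 / (3 - z₁ - 2 * z₂ - b) * exp (-lam₂ z₂ * (b - p))

/-- The function `g_π` (with parameter `b`); here `z₂ - z₁` is the distance `δ` of the firms. -/
def gPi (z₁ z₂ p b : ℝ) : ℝ :=
  2 * lam₂ z₂ / (p + (z₂ - z₁))
    - 2 * lam₂ z₂ / (b + (z₂ - z₁)) * ((1 - z₁ - b) / (3 - z₁ - 2 * z₂ - b))
      * exp (-lam₂ z₂ * (b - p))
    - 2 * lam₂ z₂ ^ 2 * exp (lam₂ z₂ * (p + (z₂ - z₁)))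
      * (Ei (-lam₂ z₂ * (b + (z₂ - z₁))) - Ei (-lam₂ z₂ * (p + (z₂ - z₁))))

def g (z₁ z₂ p b c : ℝ) : ℝ := g₀ z₁ z₂ p b - c * gPi z₁ z₂ p b

def h (z₁ z₂ p a : ℝ) : ℝ :=
  4 * lam₂ z₂ * exp (-lam₂ z₂ * (p - a))
    - 4 * lam₂ z₂ * (a - (z₂ - z₁)) / (p - (z₂ - z₁))
    + 4 * lam₂ z₂ ^ 2 * (a - (z₂ - z₁)) * exp (-lam₂ z₂ * (p - (z₂ - z₁)))
      * (Ei (lam₂ z₂ * (p - (z₂ - z₁))) - Ei (lam₂ z₂ * (a - (z₂ - z₁))))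

/-- The profit `π₁*`. -/
def eqProfit₁ (z₁ w : ℝ) : ℝ := 2 * (1 - z₁ - w)

/-- The profit `π₂*`. -/
def eqProfit₂ (z₁ z₂ w : ℝ) : ℝ :=
  g₀ z₁ z₂ (1 - z₁ - w) (1 - z₁) / gPi z₁ z₂ (1 - z₁ - w) (1 - z₁)

/-- The distribution function `F₁*`. -/
def F₁ (z₁ z₂ w p : ℝ) : ℝ :=
  if p < 1 - z₁ - w then 0
  else if p < 1 - z₁ then g z₁ z₂ p (1 - z₁) (eqProfit₂ z₁ z₂ w)
  else 1

/-- The distribution function `F₂*`. -/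
def F₂ (z₁ z₂ w p : ℝ) : ℝ :=
  if p < 1 - 2 * z₁ + z₂ - w then 0
  else if p < 1 - 2 * z₁ + z₂ then h z₁ z₂ p (1 - 2 * z₁ + z₂ - w)
  else 1

/-! ### The definitions are meaningful -/

lemma integrableOn_Iic_exp_div {a : ℝ} (ha : a < 0) :
    IntegrableOn (fun t => exp t / t) (Iic a) := by
  have h1 : IntegrableOn (fun t => exp t) (Iic a) := integrableOn_exp_Iic a
  refine Integrable.mono (h1.const_mul (|a|⁻¹)) ?_ ?_
  · exact (by fun_prop : Measurable fun t : ℝ => exp t / t).aestronglyMeasurable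
  · filter_upwards [ae_restrict_mem measurableSet_Iic] with t ht
    have ht' : t ≤ a := ht
    rw [norm_div, norm_mul, div_eq_inv_mul, Real.norm_eq_abs t, norm_inv, Real.norm_eq_abs |a|,
      abs_abs]
    have : |a| ≤ |t| := by rw [abs_of_neg ha, abs_of_neg (by linarith)]; linarith
    have h0 : 0 < |a| := abs_pos.mpr ha.ne
    gcongr

/-- `Ei z` is the principal value `lim_{ε ↓ 0} ∫_{t ≤ z, |t| ≥ ε} exp t / t dt`. -/
theorem tendsto_Ei {z : ℝ} (hz : z ≠ 0) :
    Tendsto (fun ε : ℝ => ∫ t in Iic z \ Ioo (-ε) ε, exp t / t) (𝓝[>] 0) (𝓝 (Ei z)) := by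
  rcases lt_or_gt_of_ne hz with hz | hz
  · refine tendsto_const_nhds.congr' ?_
    filter_upwards [Ioo_mem_nhdsGT (neg_pos.mpr hz)] with ε hε
    have h1 : Iic z \ Ioo (-ε) ε = Iic z := by
      ext t
      simp only [Set.mem_sdiff, mem_Iic, mem_Ioo, and_iff_left_iff_imp, not_and, not_lt]
      intro ht h2
      linarith [hε.1, hε.2]
    rw [h1, Ei, abs_of_neg hz, max_eq_right hz.le]
    simp
  · set f : ℝ → ℝ := fun t => exp t - exp (-t) with hf
    set k : ℝ → ℝ := dslope f 0 with hk
    have hfd : Differentiable ℝ f := by fun_prop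
    have hkc : Continuous k := by
      rw [continuous_iff_continuousAt]
      intro x
      rcases eq_or_ne x 0 with rfl | hx
      · exact continuousAt_dslope_same.mpr (hfd 0)
      · exact (continuousAt_dslope_of_ne hx).mpr hfd.continuous.continuousAt
    have hkf : ∀ t, t ≠ 0 → k t = (exp t - exp (-t)) / t := by
      intro t ht
      rw [hk, dslope_of_ne _ ht, slope_def_field, hf]
      simp
    have hEi : Ei z = (∫ t in Iic (-z), exp t / t) + ∫ t in (0 : ℝ)..z, k t := by
      rw [Ei, abs_of_pos hz, max_eq_left hz.le]
      congr 1
      refine intervalIntegral.integral_congr_ae (Eventually.of_forall fun t ht => ?_)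
      rw [uIoc_of_le hz.le] at ht
      exact (hkf t ht.1.ne').symm
    have hlim : Tendsto (fun ε : ℝ => (∫ t in Iic (-z), exp t / t) + ∫ t in ε..z, k t) (𝓝[>] 0)
        (𝓝 (Ei z)) := by
      rw [hEi]
      refine tendsto_const_nhds.add ?_
      have h1 : Continuous fun ε : ℝ => ∫ t in z..ε, k t :=
        intervalIntegral.continuous_primitive (fun a b => hkc.intervalIntegrable a b) z
      have h2 : Continuous fun ε : ℝ => ∫ t in ε..z, k t := by
        refine h1.neg.congr fun ε => ?_
        simp only [Pi.neg_apply]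
        exact (intervalIntegral.integral_symm z ε).symm
      exact (h2.tendsto 0).mono_left nhdsWithin_le_nhds
    refine hlim.congr' ?_
    filter_upwards [Ioo_mem_nhdsGT hz] with ε hε
    obtain ⟨hε0, hεz⟩ := hε
    have h1 : Iic z \ Ioo (-ε) ε = (Iic (-z) ∪ Ioc (-z) (-ε)) ∪ Icc ε z := by
      ext t
      simp only [Set.mem_sdiff, mem_Iic, mem_Ioo, mem_union, mem_Ioc, mem_Icc, not_and, not_lt]
      grind
    have i1 : IntegrableOn (fun t => exp t / t) (Iic (-z)) := integrableOn_Iic_exp_div (by linarith)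
    have i2 : IntegrableOn (fun t => exp t / t) (Ioc (-z) (-ε)) :=
      (integrableOn_Iic_exp_div (a := -ε) (by linarith)).mono_set fun t ht => ht.2
    have c3 : ContinuousOn (fun t => exp t / t) (Icc ε z) := by
      refine ContinuousOn.div (by fun_prop) (by fun_prop) fun t ht => ?_
      have := ht.1
      linarith
    have c4 : ContinuousOn (fun t => exp (-t) / -t) (Icc ε z) := by
      refine ContinuousOn.div (by fun_prop) (by fun_prop) fun t ht => ?_
      have := ht.1
      intro h0
      linarith
    have i3 : IntegrableOn (fun t => exp t / t) (Icc ε z) := c3.integrableOn_Icc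
    have d1 : Disjoint (Iic (-z) ∪ Ioc (-z) (-ε)) (Icc ε z) := by
      rw [Set.disjoint_left]
      simp only [mem_union, mem_Iic, mem_Ioc, mem_Icc]
      grind
    have d2 : Disjoint (Iic (-z)) (Ioc (-z) (-ε)) := by
      rw [Set.disjoint_left]
      simp only [mem_Iic, mem_Ioc]
      grind
    rw [h1, setIntegral_union d1 measurableSet_Icc (i1.union i2) i3,
      setIntegral_union d2 measurableSet_Ioc i1 i2, add_assoc]
    congr 1
    rw [← intervalIntegral.integral_of_le (by linarith), integral_Icc_eq_integral_Ioc,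
      ← intervalIntegral.integral_of_le hεz.le,
      ← intervalIntegral.integral_comp_neg (fun t => exp t / t),
      ← intervalIntegral.integral_add]
    · refine intervalIntegral.integral_congr fun t ht => ?_
      rw [uIcc_of_le hεz.le] at ht
      have ht0 : t ≠ 0 := by linarith [ht.1]
      simp only [hkf t ht0]
      field_simp
      ring
    · exact (uIcc_of_le hεz.le ▸ c4).intervalIntegrable
    · exact (uIcc_of_le hεz.le ▸ c3).intervalIntegrable

lemma share_nonneg (u u' : ℝ) : 0 ≤ share u u' := by
  unfold share; split_ifs <;> norm_num

lemma share_le_one (u u' : ℝ) : share u u' ≤ 1 := by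
  unfold share; split_ifs <;> norm_num

lemma measurable_share : Measurable (fun x : ℝ × ℝ => share x.1 x.2) := by
  unfold share
  refine Measurable.ite ?_ measurable_const (Measurable.ite ?_ measurable_const measurable_const)
  · exact (measurableSet_lt measurable_fst measurable_const).union
      (measurableSet_lt measurable_fst measurable_snd)
  · exact measurableSet_eq_fun measurable_fst measurable_snd

/-- Profits are integrable for all mixed strategies, so that expected profits are never junk. -/
theorem integrable_profit (e z z' : ℝ) {μ ν : Measure ℝ} (hμ : IsMixedStrategy μ)
    (hν : IsMixedStrategy ν) :
    Integrable (fun x : ℝ × ℝ => profit e z x.1 z' x.2) (μ.prod ν) := by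
  have := hμ.1
  have := hν.1
  have hm : StronglyMeasurable fun x : ℝ × ℝ => informedDemand z x.1 z' x.2 := by
    have h1 : Measurable fun y : (ℝ × ℝ) × ℝ =>
        share (utility z y.1.1 y.2) (utility z' y.1.2 y.2) := by
      refine measurable_share.comp (Measurable.prodMk ?_ ?_) <;> fun_prop
    exact h1.stronglyMeasurable.integral_prod_right'
  have hc : Measurable fun x : ℝ × ℝ => captiveDemand e z x.1 := by
    unfold captiveDemand utility
    exact Measurable.ite (measurableSet_le measurable_const (by fun_prop)) measurable_const
      measurable_const
  have hp : Measurable fun x : ℝ × ℝ => profit e z x.1 z' x.2 :=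
    measurable_fst.mul (hc.add hm.measurable)
  have hnonneg : ∀ᵐ x ∂(μ.prod ν), 0 ≤ x.1 := by
    have h1 : ∀ᵐ p ∂μ, 0 ≤ p := by
      rw [ae_iff]
      simp only [not_le]
      exact hμ.2
    exact Measure.quasiMeasurePreserving_fst.ae h1
  refine Integrable.of_bound hp.aestronglyMeasurable 2 ?_
  filter_upwards [hnonneg] with x hx
  have hD0 : 0 ≤ informedDemand z x.1 z' x.2 := integral_nonneg fun t => share_nonneg _ _
  have hD1 : informedDemand z x.1 z' x.2 ≤ 1 := by
    have h1 := norm_setIntegral_le_of_norm_le_const (μ := volume) (s := Ioo (0 : ℝ) 1) (C := 1)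
      (f := fun t => share (utility z x.1 t) (utility z' x.2 t)) (by simp)
      (fun t _ => by rw [norm_of_nonneg (share_nonneg _ _)]; exact share_le_one _ _)
    have h2 : volume.real (Ioo (0 : ℝ) 1) = 1 := by simp
    rw [h2, mul_one] at h1
    exact (le_abs_self _).trans h1
  rw [profit]
  by_cases h1 : x.1 ≤ 1
  · have h2 : 0 ≤ captiveDemand e z x.1 ∧ captiveDemand e z x.1 ≤ 1 := by
      unfold captiveDemand
      split_ifs <;> norm_num
    rw [norm_of_nonneg (mul_nonneg hx (add_nonneg h2.1 hD0))]
    nlinarith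
  · have h2 : captiveDemand e z x.1 = 0 := by
      unfold captiveDemand utility
      rw [if_neg]
      have := abs_nonneg (e - z)
      linarith
    have h3 : informedDemand z x.1 z' x.2 = 0 := by
      unfold informedDemand
      have : ∀ t, share (utility z x.1 t) (utility z' x.2 t) = 0 := by
        intro t
        unfold share
        rw [if_pos]
        left
        unfold utility
        have := abs_nonneg (t - z)
        linarith
      simp [this]
    rw [h2, h3]
    simp

theorem integrable_profit₁ (z₁ z₂ : ℝ) {μ ν : Measure ℝ} (hμ : IsMixedStrategy μ)
    (hν : IsMixedStrategy ν) :
    Integrable (fun p : ℝ × ℝ => profit₁ z₁ z₂ p.1 p.2) (μ.prod ν) :=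
  integrable_profit 0 z₁ z₂ hμ hν

theorem integrable_profit₂ (z₁ z₂ : ℝ) {μ ν : Measure ℝ} (hμ : IsMixedStrategy μ)
    (hν : IsMixedStrategy ν) :
    Integrable (fun p : ℝ × ℝ => profit₂ z₁ z₂ p.1 p.2) (μ.prod ν) := by
  have := hμ.1
  have := hν.1
  exact (integrable_profit 1 z₂ z₁ hν hμ).swap

end SpatialCompetition

end

open SpatialCompetition

noncomputable section

namespace SpatialCompetition

open Real Set Filter Topology MeasureTheory

/-! ### Calculus preliminaries -/

/-! Notation in the comments: d = z₂ - z₁, ζ = 1 - z₂, l = 1/(2ζ), B = 1 - z₁, A = B - w, b = B + d,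
a = A + d, and c is the profit of Firm 2. Firm 2's support [a, b] is Firm 1's support [A, B] shifted
by d. A price p of Firm 1 therefore shares the informed consumers with rival prices below p + d and
takes all of them from those above; dually for Firm 2.

Indifference of each firm is a linear first-order equation for the rival's law: H' = l(4A/(y - d)² -
H) for the distribution function H of Firm 2, and T' = l(T - 2c/(y + d)²) for the tail T of Firm 1.
`h` and `tail` solve these equations. The equations give closed primitives of density times an
affine function (`hasDerivAt_primitive₁`, `hasDerivAt_primitive₂`). At the price where sharing turns
into undercutting, the coefficient of H is 1 and that of T is 0, so the payoffs collapse to 2A and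
c.

Deviations need estimates of the parameters. Comparison arguments for the two equations give
positive densities and bounds on x = lw, and `isParams` collects all that is used later. Firm 1
loses its captive buyers above B (`payoff₁_le`). Firm 2 above b sells only to captives and earns at
most z₂ ≤ c; between ζ and a its profit is bounded by a quadratic in p. The delicate prices are
those up to ζ, which undercut part of Firm 1's support: `undercut_deriv_nonneg` shows that the
profit bound increases there, so p = ζ, just below the atom, is critical, and at p = ζ the first
displayed condition is exactly what is needed. -/

lemma le_of_hasDerivAt_nonneg {f f' : ℝ → ℝ} {a b : ℝ} (hab : a ≤ b)
    (hf : ∀ x ∈ Icc a b, HasDerivAt f (f' x) x) (h0 : ∀ x ∈ Icc a b, 0 ≤ f' x) : f a ≤ f b := by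
  have hm : MonotoneOn f (Icc a b) := by
    refine monotoneOn_of_deriv_nonneg (convex_Icc a b)
      (fun x hx => (hf x hx).continuousAt.continuousWithinAt)
      (fun x hx => (hf x (interior_subset hx)).differentiableAt.differentiableWithinAt)
      fun x hx => ?_
    rw [(hf x (interior_subset hx)).deriv]
    exact h0 x (interior_subset hx)
  exact hm (left_mem_Icc.mpr hab) (right_mem_Icc.mpr hab) hab

lemma Ei_of_neg {z : ℝ} (hz : z < 0) : Ei z = ∫ t in Iic z, exp t / t := by
  rw [Ei, abs_of_neg hz, max_eq_right hz.le]
  simp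

lemma hasDerivAt_Ei_of_neg {z : ℝ} (hz : z < 0) : HasDerivAt Ei (exp z / z) z := by
  have hc : ContinuousOn (fun t : ℝ => exp t / t) (Iio 0) :=
    ContinuousOn.div (by fun_prop) (by fun_prop) fun t ht => (show t < 0 from ht).ne
  have hint : IntervalIntegrable (fun t : ℝ => exp t / t) volume (z - 1) z := by
    refine (hc.mono fun t ht => ?_).intervalIntegrable
    rw [uIcc_of_le (by linarith)] at ht
    exact ht.2.trans_lt hz
  have h1 : HasDerivAt (fun u => ∫ t in (z - 1)..u, exp t / t) (exp z / z) z :=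
    intervalIntegral.integral_hasDerivAt_right hint
      (hc.stronglyMeasurableAtFilter isOpen_Iio z hz) (hc.continuousAt (Iio_mem_nhds hz))
  have h2 := h1.const_add (∫ t in Iic (z - 1), exp t / t)
  refine h2.congr_of_eventuallyEq ?_
  filter_upwards [Iio_mem_nhds hz] with u hu
  rw [Ei_of_neg hu, ← intervalIntegral.integral_Iic_sub_Iic
    (integrableOn_Iic_exp_div (by linarith)) (integrableOn_Iic_exp_div hu)]
  ring

/-- For z > 0, Ei u = Ei(-u) + ∫₀ᵘ (eᵗ - e⁻ᵗ)/t dt near z. The removable singularity at 0 is filled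
by `dslope`, and the terms in e⁻ᶻ/z cancel. -/
lemma hasDerivAt_Ei {z : ℝ} (hz : z ≠ 0) : HasDerivAt Ei (exp z / z) z := by
  rcases lt_or_gt_of_ne hz with hz | hz
  · exact hasDerivAt_Ei_of_neg hz
  set f : ℝ → ℝ := fun t => exp t - exp (-t) with hf
  have hfd : Differentiable ℝ f := by fun_prop
  have hkc : Continuous (dslope f 0) := by
    rw [continuous_iff_continuousAt]
    intro x
    rcases eq_or_ne x 0 with rfl | hx
    · exact continuousAt_dslope_same.mpr (hfd 0)
    · exact (continuousAt_dslope_of_ne hx).mpr hfd.continuous.continuousAt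
  have hkf : ∀ t, t ≠ 0 → dslope f 0 t = (exp t - exp (-t)) / t := by
    intro t ht
    rw [dslope_of_ne _ ht, slope_def_field, hf]
    simp
  have h1 := (intervalIntegral.integral_hasDerivAt_right (hkc.intervalIntegrable 0 z)
    hkc.aestronglyMeasurable.stronglyMeasurableAtFilter hkc.continuousAt)
  have h2 : HasDerivAt (fun u => Ei (-u)) (exp (-z) / (-z) * (-1)) z :=
    (hasDerivAt_Ei_of_neg (neg_lt_zero.mpr hz)).comp z (hasDerivAt_neg z)
  have h3 := h2.add h1
  rw [hkf z hz.ne'] at h3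
  have e : exp (-z) / (-z) * (-1) + (exp z - exp (-z)) / z = exp z / z := by
    field_simp
    ring
  rw [e] at h3
  refine h3.congr_of_eventuallyEq ?_
  filter_upwards [Ioi_mem_nhds hz] with u hu
  have hu : 0 < u := hu
  simp only [Pi.add_apply]
  rw [Ei_of_neg (neg_lt_zero.mpr hu), Ei, abs_of_pos hu, max_eq_left hu.le]
  congr 1
  refine intervalIntegral.integral_congr_ae (Eventually.of_forall fun t ht => ?_)
  rw [uIoc_of_le hu.le] at ht
  exact (hkf t ht.1.ne').symm

/-! ### The differential equations of the equilibrium distribution functions -/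

/-- Indifference of Firm 1 in differential form. Variation of constants integrates exp(lu)/u²;
integration by parts turns this into the 1/u and `Ei` terms of `h`. -/
lemma hasDerivAt_h {z₁ z₂ a p : ℝ} (hl : 0 < lam₂ z₂) (hp : z₂ - z₁ < p) :
    HasDerivAt (fun p => h z₁ z₂ p a)
      (lam₂ z₂ * (4 * (a - (z₂ - z₁)) / (p - (z₂ - z₁)) ^ 2 - h z₁ z₂ p a)) p := by
  have hu : p - (z₂ - z₁) ≠ 0 := by linarith
  have hE : HasDerivAt (fun p => Ei (lam₂ z₂ * (p - (z₂ - z₁))))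
      (exp (lam₂ z₂ * (p - (z₂ - z₁))) / (lam₂ z₂ * (p - (z₂ - z₁))) * (lam₂ z₂ * 1)) p :=
    HasDerivAt.comp (h₂ := Ei) p (hasDerivAt_Ei (mul_ne_zero hl.ne' hu))
      (((hasDerivAt_id' p).sub_const (z₂ - z₁)).const_mul (lam₂ z₂))
  have h1 : HasDerivAt (fun p => exp (-lam₂ z₂ * (p - a)))
      (exp (-lam₂ z₂ * (p - a)) * (-lam₂ z₂ * 1)) p :=
    (((hasDerivAt_id' p).sub_const a).const_mul (-lam₂ z₂)).exp
  have h2 : HasDerivAt (fun p => exp (-lam₂ z₂ * (p - (z₂ - z₁))))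
      (exp (-lam₂ z₂ * (p - (z₂ - z₁))) * (-lam₂ z₂ * 1)) p :=
    (((hasDerivAt_id' p).sub_const (z₂ - z₁)).const_mul (-lam₂ z₂)).exp
  have h3 := (hasDerivAt_const p (4 * lam₂ z₂ * (a - (z₂ - z₁)))).div
    ((hasDerivAt_id' p).sub_const (z₂ - z₁)) hu
  have h4 := ((h1.const_mul (4 * lam₂ z₂)).sub h3).add
    ((h2.const_mul (4 * lam₂ z₂ ^ 2 * (a - (z₂ - z₁)))).mul
      (hE.sub_const (Ei (lam₂ z₂ * (a - (z₂ - z₁))))))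
  refine h4.congr_deriv ?_
  have e : exp (lam₂ z₂ * (p - (z₂ - z₁))) = (exp (-lam₂ z₂ * (p - (z₂ - z₁))))⁻¹ := by
    rw [← exp_neg]; ring_nf
  have := exp_pos (-lam₂ z₂ * (p - (z₂ - z₁)))
  simp only [h]
  rw [e]
  generalize exp (-lam₂ z₂ * (p - (z₂ - z₁))) = X at *
  generalize Ei (lam₂ z₂ * (p - (z₂ - z₁))) = Y at *
  generalize p - (z₂ - z₁) = u at *
  field_simp
  ring

lemma h_self {z₁ z₂ a : ℝ} (ha : z₂ - z₁ < a) : h z₁ z₂ a a = 0 := by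
  have : a - (z₂ - z₁) ≠ 0 := by linarith
  unfold h
  field_simp
  simp

/-- The parameter b enters only through multiples of exp(lp), which solve the homogeneous equation,
so it is absent from the derivative formula. -/
lemma hasDerivAt_gPi {z₁ z₂ b p : ℝ} (hl : 0 < lam₂ z₂) (hp : 0 < p + (z₂ - z₁)) :
    HasDerivAt (fun p => gPi z₁ z₂ p b)
      (lam₂ z₂ * (gPi z₁ z₂ p b - 2 / (p + (z₂ - z₁)) ^ 2)) p := by
  have hu : p + (z₂ - z₁) ≠ 0 := by linarith
  have hE : HasDerivAt (fun p => Ei (-lam₂ z₂ * (p + (z₂ - z₁))))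
      (exp (-lam₂ z₂ * (p + (z₂ - z₁))) / (-lam₂ z₂ * (p + (z₂ - z₁))) * (-lam₂ z₂ * 1)) p :=
    HasDerivAt.comp (h₂ := Ei) p (hasDerivAt_Ei (mul_ne_zero (neg_ne_zero.mpr hl.ne') hu))
      (((hasDerivAt_id' p).add_const (z₂ - z₁)).const_mul (-lam₂ z₂))
  have h1 : HasDerivAt (fun p => exp (-lam₂ z₂ * (b - p)))
      (exp (-lam₂ z₂ * (b - p)) * (-lam₂ z₂ * -1)) p :=
    (((hasDerivAt_id' p).const_sub b).const_mul (-lam₂ z₂)).exp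
  have h2 : HasDerivAt (fun p => exp (lam₂ z₂ * (p + (z₂ - z₁))))
      (exp (lam₂ z₂ * (p + (z₂ - z₁))) * (lam₂ z₂ * 1)) p :=
    (((hasDerivAt_id' p).add_const (z₂ - z₁)).const_mul (lam₂ z₂)).exp
  have h3 := (hasDerivAt_const p (2 * lam₂ z₂)).div
    ((hasDerivAt_id' p).add_const (z₂ - z₁)) hu
  have h4 := (h3.sub (h1.const_mul (2 * lam₂ z₂ / (b + (z₂ - z₁)) *
    ((1 - z₁ - b) / (3 - z₁ - 2 * z₂ - b))))).sub
    ((h2.const_mul (2 * lam₂ z₂ ^ 2)).mul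
      (hE.const_sub (Ei (-lam₂ z₂ * (b + (z₂ - z₁))))))
  refine h4.congr_deriv ?_
  have e : exp (-lam₂ z₂ * (p + (z₂ - z₁))) = (exp (lam₂ z₂ * (p + (z₂ - z₁))))⁻¹ := by
    rw [← exp_neg]; ring_nf
  have := exp_pos (lam₂ z₂ * (p + (z₂ - z₁)))
  simp only [gPi]
  rw [e]
  generalize exp (lam₂ z₂ * (p + (z₂ - z₁))) = X at *
  generalize Ei (-lam₂ z₂ * (p + (z₂ - z₁))) = Y at *
  generalize 2 * lam₂ z₂ / (b + (z₂ - z₁)) * ((1 - z₁ - b) / (3 - z₁ - 2 * z₂ - b)) = K at *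
  generalize p + (z₂ - z₁) = u at *
  field_simp
  ring

/-- The tail of the distribution `g` below the atom at `1 - z₁`. -/
def tail (z₁ z₂ c p : ℝ) : ℝ := 1 - g z₁ z₂ p (1 - z₁) c

lemma hasDerivAt_tail {z₁ z₂ c p : ℝ} (hl : 0 < lam₂ z₂) (hp : 0 < p + (z₂ - z₁)) :
    HasDerivAt (tail z₁ z₂ c)
      (lam₂ z₂ * (tail z₁ z₂ c p - 2 * c / (p + (z₂ - z₁)) ^ 2)) p := by
  have h1 : HasDerivAt (fun p => exp (-lam₂ z₂ * (1 - z₁ - p)))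
      (exp (-lam₂ z₂ * (1 - z₁ - p)) * (-lam₂ z₂ * -1)) p :=
    (((hasDerivAt_id' p).const_sub (1 - z₁)).const_mul (-lam₂ z₂)).exp
  have h2 := ((((h1.const_mul (2 / (3 - z₁ - 2 * z₂ - (1 - z₁)))).const_add 1).sub
    ((hasDerivAt_gPi (b := 1 - z₁) hl hp).const_mul c))).const_sub 1
  refine h2.congr_deriv ?_
  simp only [tail, g, g₀]
  ring

/-- Equivalently c = b(1 + ζα) with α the mass of the atom: just below its ceiling Firm 2 serves its
captives and, when Firm 1 plays the atom, the informed consumers beyond z₂. -/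
lemma tail_right {z₁ z₂ c : ℝ} (hz₂ : z₂ < 1) (hb : 0 < 1 - 2 * z₁ + z₂) :
    (1 - z₂) * tail z₁ z₂ c (1 - z₁) = c / (1 - 2 * z₁ + z₂) - 1 := by
  have h1 : 1 - z₂ ≠ 0 := by linarith
  have e : 1 - z₁ + (z₂ - z₁) = 1 - 2 * z₁ + z₂ := by ring
  have e2 : 3 - z₁ - 2 * z₂ - (1 - z₁) = 2 * (1 - z₂) := by ring
  unfold tail g g₀ gPi lam₂
  rw [e, e2]
  simp
  field_simp
  ring

/-- The profit of Firm 2 is defined so that `g` vanishes at the lower end of the support. Its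
positivity excludes a zero denominator. -/
lemma tail_left {z₁ z₂ w : ℝ} (h0 : 0 < eqProfit₂ z₁ z₂ w) :
    tail z₁ z₂ (eqProfit₂ z₁ z₂ w) (1 - z₁ - w) = 1 := by
  have : gPi z₁ z₂ (1 - z₁ - w) (1 - z₁) ≠ 0 := by
    intro h1
    simp [eqProfit₂, h1] at h0
  unfold tail g eqProfit₂
  field_simp
  ring

/-! ### Comparison estimates for the differential equations -/

section TailEquation

variable {l c d A B : ℝ} {T : ℝ → ℝ}

lemma one_lt_of_tail_coefficient (hA : 0 < A + d) (hb : B + d < 1) (hc : B + d ≤ c) {y : ℝ}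
    (hy : y ∈ Icc A B) : 1 < 2 * c / (y + d) ^ 2 := by
  have h1 : 0 < y + d := by linarith [hy.1]
  have h2 : y + d ≤ B + d := by linarith [hy.2]
  rw [one_lt_div (by positivity)]
  nlinarith

/-- The forcing term exceeds 1, so (1 - T) exp(-l(y - A)) increases from the value 0. -/
lemma tail_le_one (hl : 0 < l) (hA : 0 < A + d) (hb : B + d < 1) (hc : B + d ≤ c)
    (hT : ∀ y ∈ Icc A B, HasDerivAt T (l * (T y - 2 * c / (y + d) ^ 2)) y) (hTA : T A = 1)
    {y : ℝ} (hy : y ∈ Icc A B) : T y ≤ 1 := by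
  have h1 := le_of_hasDerivAt_nonneg (f := fun y => (1 - T y) * exp (-l * (y - A)))
    (f' := fun y => l * (2 * c / (y + d) ^ 2 - 1) * exp (-l * (y - A))) hy.1
    (fun t ht => by
      have h2 := hT t ⟨ht.1, ht.2.trans hy.2⟩
      refine ((h2.const_sub 1).mul
        (((hasDerivAt_id' t).sub_const A).const_mul (-l)).exp).congr_deriv ?_
      ring)
    (fun t ht => by
      have := one_lt_of_tail_coefficient hA hb hc (y := t) ⟨ht.1, ht.2.trans hy.2⟩
      have : 0 < 2 * c / (t + d) ^ 2 - 1 := by linarith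
      positivity)
  simp only [hTA] at h1
  have := exp_pos (-l * (y - A))
  nlinarith

lemma tail_density_pos (hl : 0 < l) (hA : 0 < A + d) (hb : B + d < 1) (hc : B + d ≤ c)
    (hT : ∀ y ∈ Icc A B, HasDerivAt T (l * (T y - 2 * c / (y + d) ^ 2)) y) (hTA : T A = 1)
    {y : ℝ} (hy : y ∈ Icc A B) : 0 < l * (2 * c / (y + d) ^ 2 - T y) := by
  have h1 := tail_le_one hl hA hb hc hT hTA hy
  have h2 := one_lt_of_tail_coefficient hA hb hc hy
  exact mul_pos hl (by linarith)

lemma tail_antitoneOn (hl : 0 < l) (hA : 0 < A + d) (hb : B + d < 1) (hc : B + d ≤ c)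
    (hT : ∀ y ∈ Icc A B, HasDerivAt T (l * (T y - 2 * c / (y + d) ^ 2)) y) (hTA : T A = 1) :
    AntitoneOn T (Icc A B) := by
  intro x hx y hy hxy
  have h1 := le_of_hasDerivAt_nonneg (f := fun y => -T y)
    (f' := fun y => -(l * (T y - 2 * c / (y + d) ^ 2))) hxy
    (fun t ht => (hT t ⟨hx.1.trans ht.1, ht.2.trans hy.2⟩).neg)
    (fun t ht => by
      have := tail_density_pos hl hA hb hc hT hTA (y := t) ⟨hx.1.trans ht.1, ht.2.trans hy.2⟩
      linarith)
  simpa using h1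

/-- The width of the support is bounded, as the atom has nonnegative mass. -/
lemma one_sub_half_le_exp (hl : 0 < l) (hAB : A ≤ B) (hA : 0 < A + d) (hc : B + d ≤ c)
    (hT : ∀ y ∈ Icc A B, HasDerivAt T (l * (T y - 2 * c / (y + d) ^ 2)) y) (hTA : T A = 1)
    (hTB : 0 ≤ T B) : 1 - (B + d) / 2 ≤ exp (-l * (B - A)) := by
  have hb : 0 < B + d := by linarith
  -- The forcing term is at least 2/(B + d); T is compared with the solution for this constant
  -- forcing, which must not become negative before B.
  have h1 := le_of_hasDerivAt_nonneg (f := fun y => (2 / (B + d) - T y) * exp (-l * (y - A)))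
    (f' := fun y => l * (2 * c / (y + d) ^ 2 - 2 / (B + d)) * exp (-l * (y - A))) hAB
    (fun t ht => by
      refine (((hT t ht).const_sub (2 / (B + d))).mul
        (((hasDerivAt_id' t).sub_const A).const_mul (-l)).exp).congr_deriv ?_
      ring)
    (fun t ht => by
      have h3 : 0 < t + d := by linarith [ht.1]
      have h4 : t + d ≤ B + d := by linarith [ht.2]
      have : 0 ≤ 2 * c / (t + d) ^ 2 - 2 / (B + d) := by
        rw [sub_nonneg, div_le_div_iff₀ hb (by positivity)]
        nlinarith
      positivity)
  simp only [hTA, sub_self, mul_zero, exp_zero, mul_one] at h1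
  have h2 := exp_pos (-l * (B - A))
  have h3 : 2 / (B + d) - 1 ≤ 2 / (B + d) * exp (-l * (B - A)) := by nlinarith
  rw [div_mul_eq_mul_div, div_sub_one hb.ne', div_le_div_iff_of_pos_right hb] at h3
  linarith

/-- The integrating factor is bounded by 1 under the integral of the forcing term. This bound later
excludes an atom of mass zero. -/
lemma tail_mul_exp_ge (hl : 0 < l) (hAB : A ≤ B) (hA : 0 < A + d) (hc : 0 ≤ c)
    (hT : ∀ y ∈ Icc A B, HasDerivAt T (l * (T y - 2 * c / (y + d) ^ 2)) y) (hTA : T A = 1) :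
    1 - 2 * l * c * (1 / (A + d) - 1 / (B + d)) ≤ T B * exp (-l * (B - A)) := by
  have h1 := le_of_hasDerivAt_nonneg
    (f := fun y => T y * exp (-l * (y - A)) - 2 * l * c * (1 / (y + d)))
    (f' := fun y => 2 * l * c / (y + d) ^ 2 * (1 - exp (-l * (y - A)))) hAB
    (fun t ht => by
      have h3 : t + d ≠ 0 := by linarith [ht.1]
      refine (((hT t ht).mul (((hasDerivAt_id' t).sub_const A).const_mul (-l)).exp).sub
        ((((hasDerivAt_const t (1 : ℝ)).div ((hasDerivAt_id' t).add_const d) h3)).const_mul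
          (2 * l * c))).congr_deriv ?_
      field_simp
      ring)
    (fun t ht => by
      have : exp (-l * (t - A)) ≤ 1 := exp_le_one_iff.mpr (by nlinarith [ht.1])
      have : 0 ≤ 1 - exp (-l * (t - A)) := by linarith
      positivity)
  simp only [hTA, sub_self, mul_zero, exp_zero, mul_one] at h1
  linarith

end TailEquation

section CdfEquation

variable {l d a b : ℝ} {H : ℝ → ℝ}

/-- Here the comparison runs backwards from H b = 1: the forcing term exceeds 1, so (H - 1) exp(l(y
- b)) increases to 0. -/
lemma cdf_eq_le_one (hl : 0 < l) (ha : 0 < a - d) (hk : (b - d) ^ 2 < 4 * (a - d))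
    (hH : ∀ y ∈ Icc a b, HasDerivAt H (l * (4 * (a - d) / (y - d) ^ 2 - H y)) y) (hHb : H b = 1)
    {y : ℝ} (hy : y ∈ Icc a b) : H y ≤ 1 ∧ 0 < l * (4 * (a - d) / (y - d) ^ 2 - H y) := by
  have hk' : ∀ t ∈ Icc a b, 1 < 4 * (a - d) / (t - d) ^ 2 := by
    intro t ht
    have h1 : 0 < t - d := by linarith [ht.1]
    have h2 : t - d ≤ b - d := by linarith [ht.2]
    rw [one_lt_div (by positivity)]
    nlinarith
  have h1 := le_of_hasDerivAt_nonneg (f := fun y => (H y - 1) * exp (l * (y - b)))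
    (f' := fun y => l * (4 * (a - d) / (y - d) ^ 2 - 1) * exp (l * (y - b))) hy.2
    (fun t ht => by
      have h2 := hH t ⟨hy.1.trans ht.1, ht.2⟩
      refine ((h2.sub_const 1).mul
        (((hasDerivAt_id' t).sub_const b).const_mul l).exp).congr_deriv ?_
      ring)
    (fun t ht => by
      have := hk' t ⟨hy.1.trans ht.1, ht.2⟩
      have : 0 < 4 * (a - d) / (t - d) ^ 2 - 1 := by linarith
      positivity)
  simp only [hHb] at h1
  have := exp_pos (l * (y - b))
  have h3 : H y ≤ 1 := by nlinarith
  exact ⟨h3, mul_pos hl (by linarith [hk' y hy])⟩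

/-- Integrating (H exp(l(y - b)))' gives 1 = ∫ 4l(a - d)/(y - d)² exp(l(y - b)) dy over [a, b]. The
exponential lies between exp(-l(b - a)) and 1; replacing it by a constant C leaves C · 4l(b - a)/(b
- d). -/
lemma width_bounds (hl : 0 < l) (hab : a ≤ b) (ha : 0 < a - d)
    (hH : ∀ y ∈ Icc a b, HasDerivAt H (l * (4 * (a - d) / (y - d) ^ 2 - H y)) y)
    (hHa : H a = 0) (hHb : H b = 1) :
    b - d ≤ 4 * (l * (b - a)) ∧ 4 * (l * (b - a)) * exp (-(l * (b - a))) ≤ b - d := by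
  have hb : 0 < b - d := by linarith
  have hder : ∀ t ∈ Icc a b, ∀ C : ℝ, HasDerivAt
      (fun y => H y * exp (l * (y - b)) + 4 * l * (a - d) * C * (1 / (y - d)))
      (4 * l * (a - d) / (t - d) ^ 2 * (exp (l * (t - b)) - C)) t := by
    intro t ht C
    have h3 : t - d ≠ 0 := by linarith [ht.1]
    refine (((hH t ht).mul (((hasDerivAt_id' t).sub_const b).const_mul l).exp).add
      ((((hasDerivAt_const t (1 : ℝ)).div ((hasDerivAt_id' t).sub_const d) h3)).const_mul
        (4 * l * (a - d) * C))).congr_deriv ?_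
    field_simp
    ring
  constructor
  · have h1 := le_of_hasDerivAt_nonneg hab (fun t ht => (hder t ht 1).neg) (fun t ht => by
      have : exp (l * (t - b)) ≤ 1 := exp_le_one_iff.mpr (by nlinarith [ht.2])
      have h2 : 0 ≤ 1 - exp (l * (t - b)) := by linarith
      have h3 : 0 ≤ 4 * l * (a - d) / (t - d) ^ 2 * (1 - exp (l * (t - b))) := by positivity
      linarith)
    simp only [Pi.neg_apply, hHa, hHb, sub_self, mul_zero, exp_zero, mul_one, zero_mul] at h1
    have h2 : 4 * l * (a - d) * (1 / (a - d)) = 4 * l := by field_simp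
    have h3 : 4 * l * (a - d) * (1 / (b - d)) = 4 * l - 4 * (l * (b - a)) / (b - d) := by
      field_simp; ring
    have h4 : 1 ≤ 4 * (l * (b - a)) / (b - d) := by linarith
    rwa [one_le_div hb] at h4
  · have h1 := le_of_hasDerivAt_nonneg hab (fun t ht => hder t ht (exp (l * (a - b))))
      (fun t ht => by
        have : exp (l * (a - b)) ≤ exp (l * (t - b)) := exp_le_exp.mpr (by nlinarith [ht.1])
        have h2 : 0 ≤ exp (l * (t - b)) - exp (l * (a - b)) := by linarith
        positivity)
    simp only [hHa, hHb, sub_self, mul_zero, exp_zero, mul_one, zero_mul] at h1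
    have e : l * (a - b) = -(l * (b - a)) := by ring
    rw [e] at h1
    generalize exp (-(l * (b - a))) = X at *
    have h2 : 4 * l * (a - d) * X * (1 / (a - d)) = 4 * l * X := by field_simp
    have h3 : 4 * l * (a - d) * X * (1 / (b - d)) = 4 * l * X - 4 * (l * (b - a)) * X / (b - d) := by
      field_simp; ring
    have h4 : 4 * (l * (b - a)) * X / (b - d) ≤ 1 := by linarith
    rwa [div_le_one hb] at h4

end CdfEquation

/-! ### Estimates for the parameters -/

/-- Since exp(-x) ≥ 1 - x, 4x(1 - x) ≤ B ≤ 1/2, so x lies below the small root (1 - √(1/2))/2 <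
0.1465 or above the large one; x ≤ log 2 excludes the latter. Then 1/(4(1 - 0.1465)) < 0.293. -/
lemma width_estimate {x B : ℝ} (hx : 0 < x) (hB : B ≤ 1 / 2) (h1 : 1 / 2 ≤ exp (-x))
    (h2 : 4 * x * exp (-x) ≤ B) : x ≤ 0.1465 ∧ x ≤ 0.293 * B := by
  have h3 : x ≤ 0.7 := by
    have h4 := log_le_log (by norm_num) h1
    rw [log_exp, one_div, log_inv] at h4
    have := log_two_lt_d9
    norm_num at this ⊢
    linarith
  have h4 : 1 - x ≤ exp (-x) := by linarith [add_one_le_exp (-x)]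
  have h5 : 4 * x * (1 - x) ≤ B := by nlinarith
  have h6 : x ≤ 0.1465 := by
    by_contra! hc
    nlinarith
  exact ⟨h6, by nlinarith⟩

/-- The first inequality is the region condition rewritten; its right side must be positive, which
for z₁ < 1 means z₁ < 2 - √2 < 0.586. -/
lemma region_estimate {z₁ z₂ : ℝ} (hz₁ : 1 / 2 ≤ z₁) (hz : z₁ < z₂) (hz₂ : z₂ < 1)
    (hregion : (1 - 2 * z₁ + z₂) * (2 - z₂) > z₂) :
    (z₂ - z₁) ^ 2 < z₁ ^ 2 - 4 * z₁ + 2 ∧ z₁ < 0.586 := by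
  have h1 : (z₂ - z₁) ^ 2 < z₁ ^ 2 - 4 * z₁ + 2 := by nlinarith
  refine ⟨h1, ?_⟩
  by_contra! hc
  nlinarith [sq_nonneg (z₂ - z₁)]

/-- The condition on the deviation that undercuts the atom of Firm 1. -/
lemma undercut_condition_iff {z₁ z₂ w c t : ℝ} (hb : 0 < 1 - 2 * z₁ + z₂)
    (ha : 0 < 1 - 2 * z₁ + z₂ - w) (hc : c = (1 - 2 * z₁ + z₂) * (1 + t)) :
    (z₁ / (1 - 2 * z₁ + z₂) + (1 - z₂) / (1 - 2 * z₁ + z₂ - w) - 1) * c =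
      (z₁ - 2 * (z₂ - z₁) + (1 - z₂) * (w / (1 - 2 * z₁ + z₂ - w))) * (1 + t) := by
  obtain ⟨b, rfl⟩ : ∃ b, z₂ = b - 1 + 2 * z₁ := ⟨1 - 2 * z₁ + z₂, by ring⟩
  have e : 1 - 2 * z₁ + (b - 1 + 2 * z₁) = b := by ring
  rw [e] at hb ha hc ⊢
  have hb' := hb.ne'
  have ha' := ha.ne'
  rw [hc]
  field_simp
  ring

/-- Here r = w/a and t = ζα. If w > 2d, then a < ζ, hence ζr ≥ w, and the condition yields (w -
2d)(1 - ζ/2) ≤ 0. -/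
lemma width_le {z₁ z₂ w t r : ℝ} (hz₁ : 1 / 2 ≤ z₁) (hz : z₁ < z₂) (hz₂ : z₂ < 1)
    (hw : 0 < w) (ha : 0 < 1 - 2 * z₁ + z₂ - w) (hwz : w < z₁) (ht : 0 ≤ t)
    (hr : r * (1 - 2 * z₁ + z₂ - w) = w)
    (hcond : (z₁ - 2 * (z₂ - z₁) + (1 - z₂) * r) * (1 + t)
      ≤ z₁ - (1 - z₂) * (z₂ - z₁) + (1 - z₂) * w / 2) : w ≤ 2 * (z₂ - z₁) := by
  by_contra! hc
  have hr0 : 0 < r := by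
    by_contra! h0
    nlinarith
  have h1 : w ≤ (1 - z₂) * r := by nlinarith
  have h2 : 0 ≤ (z₁ - 2 * (z₂ - z₁) + (1 - z₂) * r) * t := by
    apply mul_nonneg _ ht
    linarith
  nlinarith

/-- The width w is at least Bζ/2, so for close firms the condition fails: it would imply 0.7 Bζ² ≤
d(1 + z₂), which is impossible for d < 0.025, where ζ > 0.389 and B > 0.414. -/
lemma distance_ge {z₁ z₂ w t r : ℝ} (hz₁ : 1 / 2 ≤ z₁) (hz₁' : z₁ < 0.586) (hz : z₁ < z₂)
    (hz₂ : z₂ < 1) (hw : 0 < w) (ha : 0 < 1 - 2 * z₁ + z₂ - w) (ht : 0 ≤ t)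
    (hwB : (1 - z₁) * (1 - z₂) ≤ 2 * w)
    (hr : r * (1 - 2 * z₁ + z₂ - w) = w)
    (hcond : (z₁ - 2 * (z₂ - z₁) + (1 - z₂) * r) * (1 + t)
      ≤ z₁ - (1 - z₂) * (z₂ - z₁) + (1 - z₂) * w / 2) : 0.025 ≤ z₂ - z₁ := by
  by_contra! hc
  have hr0 : 0 < r := by
    by_contra! h0
    nlinarith
  -- Here a < B + d < 0.525 and 1/0.525 > 1.9.
  have h1 : 1.9 * w ≤ r := by nlinarith
  have h2 : 0 ≤ (z₁ - 2 * (z₂ - z₁) + (1 - z₂) * r) * t := by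
    apply mul_nonneg _ ht
    nlinarith
  have h3 : (1 - z₂) * (1.4 * w) ≤ (z₂ - z₁) * (1 + z₂) := by nlinarith
  have h4 : (1 - z₂) * (0.7 * ((1 - z₁) * (1 - z₂))) ≤ (z₂ - z₁) * (1 + z₂) := by nlinarith
  have h5 : (z₂ - z₁) * (1 + z₂) ≤ 0.025 * (1 + z₂) := by nlinarith
  have h6 : (0.414 : ℝ) * (1 - z₂) ^ 2 ≤ (1 - z₁) * (1 - z₂) ^ 2 := by nlinarith [sq_nonneg (1 - z₂)]
  linarith [sq_nonneg (1 - z₂ - 0.389)]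

/-- The estimate behind the monotonicity of the profits from undercutting. -/
lemma undercut_estimate {z₁ z₂ w x α : ℝ} (hz₁ : 1 / 2 ≤ z₁) (hz₁' : z₁ < 0.586)
    (hz₂ : z₂ < 1) (hd : 0.025 ≤ z₂ - z₁) (hw : w = 2 * (1 - z₂) * x)
    (hx : x ≤ 0.1465) (hx' : x ≤ 0.293 * (1 - z₁)) (hα : 0 ≤ α) (hα' : α ≤ 1)
    (hcond : z₂ ≤ (1 - 2 * z₁ + z₂) * (1 + (1 - z₂) * α)) :
    (1 - α) * (z₁ + (1 - z₂) / 2 + w / 2) + z₁ * ((1 + (1 - z₂) * α) / (1 - 2 * z₁ + z₂))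
      + z₁ * x ≤ 2 := by
  have hb : 0 < 1 - 2 * z₁ + z₂ := by linarith
  -- From z₁(1 - z₁) ≤ 1/4; the rest has to fit into 2 - 0.075 = 1.925.
  have h1 : z₁ * x ≤ 0.075 := by nlinarith
  have h2 : z₁ + (1 - z₂) / 2 + w / 2 ≤ z₁ + 0.65 * (1 - z₂) := by rw [hw]; nlinarith
  have h3 : (1 - α) * (z₁ + (1 - z₂) / 2 + w / 2) ≤ (1 - α) * (z₁ + 0.65 * (1 - z₂)) :=
    mul_le_mul_of_nonneg_left h2 (by linarith)
  suffices h4 : (1 - α) * (z₁ + 0.65 * (1 - z₂)) * (1 - 2 * z₁ + z₂) + z₁ * (1 + (1 - z₂) * α)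
      ≤ 1.925 * (1 - 2 * z₁ + z₂) by
    have h5 : (1 - α) * (z₁ + 0.65 * (1 - z₂)) + z₁ * ((1 + (1 - z₂) * α) / (1 - 2 * z₁ + z₂))
        ≤ 1.925 := by
      rw [← le_sub_iff_add_le', mul_div_assoc', div_le_iff₀ hb]
      linarith
    linarith
  have h6 : (1 - α) * (2 * (z₂ - z₁) * z₁) ≤ 2 * (z₂ - z₁) * z₁ := by
    nlinarith [mul_nonneg hα
      (mul_nonneg (sub_nonneg.mpr (by linarith : z₁ ≤ z₂)) (by linarith : 0 ≤ z₁))]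
  -- By `hcond` the atom is large enough: αζb ≥ z₂ - b = 2z₁ - 1.
  have h7 : 0.65 * ((1 - α) * ((1 - z₂) * (1 - 2 * z₁ + z₂)))
      ≤ 0.65 * ((1 - 2 * z₁ + z₂) * (1 - z₂) - 2 * z₁ + 1) := by nlinarith
  have h8 : z₁ * (2 - z₂) + 0.65 * ((1 - 2 * z₁ + z₂) * (1 - z₂) - 2 * z₁ + 1)
      + 2 * (z₂ - z₁) * z₁ ≤ 1.925 * (1 - 2 * z₁ + z₂) := by
    obtain ⟨d, rfl⟩ : ∃ d, z₂ = z₁ + d := ⟨z₂ - z₁, by ring⟩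
    have hd : 0.025 ≤ d := by linarith
    linarith [mul_nonneg (sub_nonneg.mpr hd) (sub_nonneg.mpr hz₁'.le),
      sq_nonneg (z₁ - 0.586), sq_nonneg d]
  linarith

/-- The parameters of the equilibrium: `c` is the profit of Firm 2 and `α` the mass of the atom. -/
structure IsParams (z₁ z₂ w c α : ℝ) : Prop where
  half_le : 1 / 2 ≤ z₁
  lt_bound : z₁ < 0.586
  lt : z₁ < z₂
  lt_one : z₂ < 1
  w_pos : 0 < w
  w_le : w ≤ 2 * (z₂ - z₁)
  w_le' : w ≤ 0.586 * (1 - z₁) * (1 - z₂)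
  α_pos : 0 < α
  c_eq : c = (1 - 2 * z₁ + z₂) * (1 + (1 - z₂) * α)
  le_c : z₂ ≤ c
  undercut : (1 - α) * (z₁ + (1 - z₂) / 2 + w / 2) +
    z₁ * ((1 + (1 - z₂) * α) / (1 - 2 * z₁ + z₂)) + z₁ * (w / (2 * (1 - z₂))) ≤ 2
  deviation : (z₁ / (1 - 2 * z₁ + z₂) + (1 - z₂) / (1 - 2 * z₁ + z₂ - w) - 1) * c
    ≤ z₁ - (1 - z₂) * (z₂ - z₁) + (1 - z₂) * w / 2
  hasDerivAt_tail : ∀ y ∈ Icc (1 - z₁ - w) (1 - z₁), HasDerivAt (tail z₁ z₂ c)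
    (1 / (2 * (1 - z₂)) * (tail z₁ z₂ c y - 2 * c / (y + (z₂ - z₁)) ^ 2)) y
  tail_left : tail z₁ z₂ c (1 - z₁ - w) = 1
  tail_right : tail z₁ z₂ c (1 - z₁) = α
  hasDerivAt_h : ∀ y ∈ Icc (1 - 2 * z₁ + z₂ - w) (1 - 2 * z₁ + z₂),
    HasDerivAt (fun p => h z₁ z₂ p (1 - 2 * z₁ + z₂ - w))
    (1 / (2 * (1 - z₂)) * (4 * (1 - z₁ - w) / (y - (z₂ - z₁)) ^ 2
      - h z₁ z₂ y (1 - 2 * z₁ + z₂ - w))) y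
  h_right : h z₁ z₂ (1 - 2 * z₁ + z₂) (1 - 2 * z₁ + z₂ - w) = 1

theorem isParams {z₁ z₂ w : ℝ} (hz₁ : 1 / 2 ≤ z₁) (hz : z₁ < z₂) (hz₂ : z₂ ≤ 1)
    (hregion : (1 - 2 * z₁ + z₂) * (2 - z₂) > z₂) (hw : 0 < w) (hw' : w < 1 - z₁)
    (hroot : h z₁ z₂ (1 - 2 * z₁ + z₂) (1 - 2 * z₁ + z₂ - w) = 1)
    (hcond_a : z₁ - (1 - z₂) * (z₂ - z₁) + (1 - z₂) * w / 2 ≥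
      (z₁ / (1 - 2 * z₁ + z₂) + (1 - z₂) / (1 - 2 * z₁ + z₂ - w) - 1) * eqProfit₂ z₁ z₂ w)
    (hcond_b : eqProfit₂ z₁ z₂ w ≥ z₂) :
    IsParams z₁ z₂ w (eqProfit₂ z₁ z₂ w) (tail z₁ z₂ (eqProfit₂ z₁ z₂ w) (1 - z₁)) := by
  -- At z₂ = 1 the convention 1/0 = 0 makes `lam₂` and hence `h` vanish, so there is no root.
  have hz₂' : z₂ < 1 := by
    refine lt_of_le_of_ne hz₂ fun h1 => ?_
    subst h1
    simp [h, lam₂] at hroot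
  have hl : 0 < lam₂ z₂ := by
    unfold lam₂
    have : 0 < 1 - z₂ := by linarith
    positivity
  have hb : 0 < 1 - 2 * z₁ + z₂ := by linarith
  have hb' : 1 - 2 * z₁ + z₂ ≤ z₂ := by linarith
  have ha : 0 < 1 - 2 * z₁ + z₂ - w := by linarith
  obtain ⟨-, hz₁'⟩ := region_estimate hz₁ hz hz₂' hregion
  have hTA := tail_left (z₁ := z₁) (z₂ := z₂) (w := w) (by linarith)
  have hTB := tail_right (z₁ := z₁) (c := eqProfit₂ z₁ z₂ w) hz₂' hb
  have hT : ∀ y ∈ Icc (1 - z₁ - w) (1 - z₁), HasDerivAt (tail z₁ z₂ (eqProfit₂ z₁ z₂ w))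
    (lam₂ z₂ * (tail z₁ z₂ (eqProfit₂ z₁ z₂ w) y
      - 2 * eqProfit₂ z₁ z₂ w / (y + (z₂ - z₁)) ^ 2)) y :=
    fun y hy => hasDerivAt_tail hl (by linarith [hy.1])
  have hH : ∀ y ∈ Icc (1 - 2 * z₁ + z₂ - w) (1 - 2 * z₁ + z₂),
      HasDerivAt (fun p => h z₁ z₂ p (1 - 2 * z₁ + z₂ - w))
      (lam₂ z₂ * (4 * (1 - 2 * z₁ + z₂ - w - (z₂ - z₁)) / (y - (z₂ - z₁)) ^ 2
        - h z₁ z₂ y (1 - 2 * z₁ + z₂ - w))) y :=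
    fun y hy => hasDerivAt_h hl (by linarith [hy.1])
  have hHa := h_self (z₁ := z₁) (z₂ := z₂) (a := 1 - 2 * z₁ + z₂ - w) (by linarith)
  generalize eqProfit₂ z₁ z₂ w = c at *
  have hc : c = (1 - 2 * z₁ + z₂) * (1 + (1 - z₂) * tail z₁ z₂ c (1 - z₁)) := by
    rw [hTB]
    field_simp
    ring
  have hA : 0 < 1 - z₁ - w + (z₂ - z₁) := by linarith
  -- A negative mass would give c < b ≤ z₂.
  have hα : 0 ≤ tail z₁ z₂ c (1 - z₁) := by
    by_contra! h0
    have := mul_neg_of_pos_of_neg (mul_pos hb (sub_pos.mpr hz₂')) h0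
    linarith
  have hα' := tail_le_one hl hA (by linarith) (by linarith) hT hTA
    (y := 1 - z₁) ⟨by linarith, le_rfl⟩
  have hexp := one_sub_half_le_exp hl (by linarith) hA (by linarith) hT hTA hα
  have hmul := tail_mul_exp_ge hl (by linarith) hA (by linarith) hT hTA
  obtain ⟨hx1, hx2⟩ := width_bounds hl (by linarith) (by linarith) hH hHa hroot
  have ew : w = 2 * (1 - z₂) * (lam₂ z₂ * w) := by
    unfold lam₂
    have : 1 - z₂ ≠ 0 := by linarith
    field_simp
  have e1 : lam₂ z₂ * (1 - 2 * z₁ + z₂ - (1 - 2 * z₁ + z₂ - w)) = lam₂ z₂ * w := by ring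
  have e2 : -lam₂ z₂ * (1 - z₁ - (1 - z₁ - w)) = -(lam₂ z₂ * w) := by ring
  have e3 : 1 - 2 * z₁ + z₂ - (z₂ - z₁) = 1 - z₁ := by ring
  have e4 : lam₂ z₂ * w = w / (2 * (1 - z₂)) := by unfold lam₂; ring
  rw [e1, e3] at hx1 hx2
  rw [e2] at hexp hmul
  obtain ⟨hx3, hx4⟩ := width_estimate (mul_pos hl hw) (by linarith) (by linarith) hx2
  have el : 1 / (2 * (1 - z₂)) = lam₂ z₂ := rfl
  have hζ : 0 < 1 - z₂ := by linarith
  have hw3 : w ≤ 0.586 * (1 - z₁) * (1 - z₂) := by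
    linarith [mul_le_mul_of_nonneg_left hx4 hζ.le]
  have hcond := hcond_a
  rw [ge_iff_le, undercut_condition_iff hb ha hc] at hcond
  have ht : 0 ≤ (1 - z₂) * tail z₁ z₂ c (1 - z₁) := mul_nonneg hζ.le hα
  have hr : w / (1 - 2 * z₁ + z₂ - w) * (1 - 2 * z₁ + z₂ - w) = w := by field_simp
  have hd := distance_ge hz₁ hz₁' hz hz₂' hw ha ht
    (by linarith [mul_le_mul_of_nonneg_right hx1 hζ.le]) hr hcond
  refine
    { half_le := hz₁, lt_bound := hz₁', lt := hz, lt_one := hz₂', w_pos := hw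
      w_le := width_le hz₁ hz hz₂' hw ha (by linarith) ht hr hcond
      w_le' := hw3
      α_pos := ?_, c_eq := hc, le_c := hcond_b
      undercut := ?_, deviation := hcond_a, hasDerivAt_tail := by rw [el]; exact hT, tail_left := hTA
      tail_right := rfl, hasDerivAt_h := ?_, h_right := hroot }
  -- If α = 0, then c = b and the tail bound gives a ≤ 2x. With w = 2ζx and ζ ≤ 1/2 this means b ≤
  -- 3x ≤ 0.879 B < b.
  · refine lt_of_le_of_ne hα fun h0 => ?_
    rw [← h0, mul_zero, add_zero, mul_one] at hc
    rw [← h0, zero_mul] at hmul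
    have e5 : 2 * lam₂ z₂ * c * (1 / (1 - z₁ - w + (z₂ - z₁)) - 1 / (1 - z₁ + (z₂ - z₁)))
        = 2 * (lam₂ z₂ * w) / (1 - 2 * z₁ + z₂ - w) := by
      have e6 : 1 - z₁ - w + (z₂ - z₁) = 1 - 2 * z₁ + z₂ - w := by ring
      have e7 : 1 - z₁ + (z₂ - z₁) = 1 - 2 * z₁ + z₂ := by ring
      rw [e6, e7, hc]
      field_simp
      ring
    rw [e5, sub_nonpos, one_le_div ha] at hmul
    linarith [mul_nonneg (by linarith : 0 ≤ 1 / 2 - (1 - z₂)) (mul_pos hl hw).le]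
  · rw [← e4]
    exact undercut_estimate hz₁ hz₁' hz₂' hd ew hx3 hx4 hα hα' (hc ▸ hcond_b)
  · intro y hy
    have e6 : 1 - z₁ - w = 1 - 2 * z₁ + z₂ - w - (z₂ - z₁) := by ring
    rw [e6, el]
    exact hH y hy

/-! ### Demand -/

lemma integrableOn_share (z p z' p' : ℝ) :
    IntegrableOn (fun t => share (utility z p t) (utility z' p' t)) (Ioo (0 : ℝ) 1) := by
  have hm : Measurable fun t : ℝ => share (utility z p t) (utility z' p' t) := by
    refine measurable_share.comp (f := fun t : ℝ => (utility z p t, utility z' p' t))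
      (Measurable.prodMk ?_ ?_) <;> unfold utility <;> fun_prop
  refine Integrable.of_bound hm.aestronglyMeasurable 1 (Eventually.of_forall fun t => ?_)
  rw [norm_of_nonneg (share_nonneg _ _)]
  exact share_le_one _ _

lemma informedDemand_le {z p z' p' u v : ℝ}
    (h0 : ∀ t ∈ Ioo (0 : ℝ) 1, t < u ∨ v < t → share (utility z p t) (utility z' p' t) = 0) :
    informedDemand z p z' p' ≤ max (v - u) 0 := by
  have h1 : informedDemand z p z' p'
      ≤ ∫ t in Ioo (0 : ℝ) 1, (Icc u v).indicator (fun _ => (1 : ℝ)) t := by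
    refine setIntegral_mono_on (integrableOn_share _ _ _ _)
      ((integrable_const (1 : ℝ)).indicator measurableSet_Icc) measurableSet_Ioo fun t ht => ?_
    by_cases hu : t ∈ Icc u v
    · rw [indicator_of_mem hu]
      exact share_le_one _ _
    · rw [indicator_of_notMem hu, h0 t ht]
      rw [mem_Icc, not_and_or, not_le, not_le] at hu
      exact hu
  refine h1.trans ?_
  rw [setIntegral_indicator measurableSet_Icc, setIntegral_const, smul_eq_mul, mul_one,
    ← Real.volume_real_Icc]
  exact measureReal_mono inter_subset_right (by simp)

lemma le_informedDemand {z p z' p' u v : ℝ} (hu : 0 ≤ u) (huv : u ≤ v) (hv : v ≤ 1)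
    (h1 : ∀ t ∈ Ioo u v, share (utility z p t) (utility z' p' t) = 1) :
    v - u ≤ informedDemand z p z' p' := by
  have hsub : Ioo u v ⊆ Ioo (0 : ℝ) 1 := Ioo_subset_Ioo hu hv
  have h2 : ∫ t in Ioo u v, share (utility z p t) (utility z' p' t) = v - u := by
    rw [setIntegral_congr_fun measurableSet_Ioo h1, setIntegral_const, smul_eq_mul, mul_one,
      Real.volume_real_Ioo_of_le huv]
  rw [← h2]
  exact setIntegral_mono_set (integrableOn_share _ _ _ _)
    (Eventually.of_forall fun t => share_nonneg _ _) hsub.eventuallyLE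

lemma informedDemand_nonneg (z p z' p' : ℝ) : 0 ≤ informedDemand z p z' p' :=
  integral_nonneg fun _ => share_nonneg _ _

lemma informedDemand_le_one (z p z' p' : ℝ) : informedDemand z p z' p' ≤ 1 := by
  have h1 := informedDemand_le (z := z) (p := p) (z' := z') (p' := p') (u := 0) (v := 1)
    fun t ht hu => by
      rcases hu with hu | hu
      · exact absurd ht.1 hu.not_gt
      · exact absurd ht.2 hu.not_gt
  simpa using h1

lemma share_eq_zero {z p z' p' t : ℝ} (h0 : p' + |t - z'| < p + |t - z|) :
    share (utility z p t) (utility z' p' t) = 0 := by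
  unfold share utility
  rw [if_pos (Or.inr (by linarith))]

lemma share_eq_zero_of_neg {z p z' p' t : ℝ} (h0 : 1 < p + |t - z|) :
    share (utility z p t) (utility z' p' t) = 0 := by
  unfold share utility
  rw [if_pos (Or.inl (by linarith))]

lemma share_eq_one {z p z' p' t : ℝ} (h0 : p + |t - z| < p' + |t - z'|) (h1 : p + |t - z| ≤ 1) :
    share (utility z p t) (utility z' p' t) = 1 := by
  unfold share utility
  rw [if_neg (by push Not; constructor <;> linarith), if_neg (by linarith)]

section Firms

variable {z₁ z₂ p y : ℝ}

lemma informedDemand₁_eq_one (hz₁ : 1 / 2 ≤ z₁) (hz : z₁ < z₂) (hp : p ≤ 1 - z₁)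
    (hy : p + (z₂ - z₁) < y) : informedDemand z₁ p z₂ y = 1 := by
  refine le_antisymm (informedDemand_le_one _ _ _ _) ?_
  have h1 := le_informedDemand (z := z₁) (p := p) (z' := z₂) (p' := y) le_rfl zero_le_one le_rfl
    fun t ht => share_eq_one (by
      rcases abs_cases (t - z₁) with h1 | h1 <;> rcases abs_cases (t - z₂) with h2 | h2 <;> linarith)
      (by rcases abs_cases (t - z₁) with h1 | h1 <;> linarith [ht.1, ht.2])
  linarith

/-- Above 1 - z₁ the consumers left of p + z₁ - 1 are too far away to buy. -/
lemma informedDemand₁_le (hz : z₁ < z₂) (hy : y < p + (z₂ - z₁)) :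
    informedDemand z₁ p z₂ y ≤ max ((y - p + z₁ + z₂) / 2 - max 0 (p + z₁ - 1)) 0 := by
  refine informedDemand_le fun t ht h0 => ?_
  rcases h0 with h0 | h0
  · refine share_eq_zero_of_neg ?_
    rcases max_cases 0 (p + z₁ - 1) with h2 | h2 <;>
      rcases abs_cases (t - z₁) with h1 | h1 <;> linarith [ht.1]
  · refine share_eq_zero ?_
    rcases abs_cases (t - z₁) with h1 | h1 <;> rcases abs_cases (t - z₂) with h2 | h2 <;> linarith

/-- The strict bounds exclude y = p ± d, where a whole interval of consumers is indifferent and the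
tie rule matters. `hp` ensures that even the consumer at 0 would buy. -/
lemma informedDemand₁_eq (hz₁ : 1 / 2 ≤ z₁) (hz : z₁ < z₂) (hz₂ : z₂ < 1) (hp : p ≤ 1 - z₁)
    (hy : p - (z₂ - z₁) < y) (hy' : y < p + (z₂ - z₁)) :
    informedDemand z₁ p z₂ y = (y - p + z₁ + z₂) / 2 := by
  refine le_antisymm ?_ ?_
  · refine (informedDemand₁_le hz hy').trans_eq ?_
    rw [max_eq_left (by linarith : p + z₁ - 1 ≤ 0), max_eq_left (by linarith), sub_zero]
  · have h1 := le_informedDemand (z := z₁) (p := p) (z' := z₂) (p' := y) (u := 0)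
      (v := (y - p + z₁ + z₂) / 2) le_rfl (by linarith) (by linarith) fun t ht => share_eq_one (by
        rcases abs_cases (t - z₁) with h1 | h1 <;> rcases abs_cases (t - z₂) with h2 | h2 <;>
          linarith [ht.2]) (by
        rcases abs_cases (t - z₁) with h1 | h1 <;> linarith [ht.1, ht.2])
    linarith

lemma informedDemand₂_eq_zero (hy : y < p - (z₂ - z₁)) (hz : z₁ < z₂) :
    informedDemand z₂ p z₁ y = 0 := by
  refine le_antisymm ?_ (informedDemand_nonneg _ _ _ _)
  have h1 := informedDemand_le (z := z₂) (p := p) (z' := z₁) (p' := y) (u := 1) (v := 1)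
    fun t ht _ => share_eq_zero (by
      rcases abs_cases (t - z₁) with h1 | h1 <;> rcases abs_cases (t - z₂) with h2 | h2 <;> linarith)
  simpa using h1

lemma informedDemand₂_le (hz : z₁ < z₂) (hz₂ : z₂ < 1) (hy : p - (z₂ - z₁) ≤ y)
    (hy' : y < p + (z₂ - z₁)) : informedDemand z₂ p z₁ y ≤ 1 - (p - y + z₁ + z₂) / 2 := by
  have h1 := informedDemand_le (z := z₂) (p := p) (z' := z₁) (p' := y)
    (u := (p - y + z₁ + z₂) / 2) (v := 1) fun t ht h0 => by
      rcases h0 with h0 | h0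
      · refine share_eq_zero ?_
        rcases abs_cases (t - z₁) with h1 | h1 <;> rcases abs_cases (t - z₂) with h2 | h2 <;>
          linarith
      · linarith [ht.2]
  rwa [max_eq_left (by linarith)] at h1

lemma informedDemand₂_eq (hz : z₁ < z₂) (hz₂ : z₂ < 1) (hz₁ : 1 / 2 ≤ z₁)
    (hy : p - (z₂ - z₁) < y) (hy' : y < p + (z₂ - z₁))
    (hyB : y ≤ 1 - z₁) : informedDemand z₂ p z₁ y = 1 - (p - y + z₁ + z₂) / 2 := by
  refine le_antisymm (informedDemand₂_le hz hz₂ hy.le hy') ?_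
  refine le_informedDemand (by linarith) (by linarith) le_rfl fun t ht => share_eq_one (by
    rcases abs_cases (t - z₁) with h1 | h1 <;> rcases abs_cases (t - z₂) with h2 | h2 <;>
      linarith [ht.1]) (by
    rcases abs_cases (t - z₂) with h1 | h1 <;> linarith [ht.1, ht.2])

lemma captiveDemand₁ (hz₁ : 0 ≤ z₁) :
    captiveDemand 0 z₁ p = if p ≤ 1 - z₁ then 1 else 0 := by
  unfold captiveDemand utility
  rw [zero_sub, abs_neg, abs_of_nonneg hz₁]
  congr 1
  exact propext ⟨fun h => by linarith, fun h => by linarith⟩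

lemma captiveDemand₂ (hz₂ : z₂ ≤ 1) :
    captiveDemand 1 z₂ p = if p ≤ z₂ then 1 else 0 := by
  unfold captiveDemand utility
  rw [abs_of_nonneg (by linarith)]
  congr 1
  exact propext ⟨fun h => by linarith, fun h => by linarith⟩

lemma captiveDemand_le_one (e z p : ℝ) : captiveDemand e z p ≤ 1 := by
  unfold captiveDemand
  split_ifs <;> norm_num

end Firms

/-! ### Distributions with a density and an atom -/

/-- The measure with density `f` on `(A, B]` and an atom of mass `α` at `B`. -/
def densityWithAtom (f : ℝ → ℝ) (A B α : ℝ) : Measure ℝ :=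
  (volume.restrict (Ioc A B)).withDensity (fun y => ENNReal.ofReal (f y))
    + ENNReal.ofReal α • Measure.dirac B

section DensityWithAtom

variable {f F : ℝ → ℝ} {A B α : ℝ}

lemma aemeasurable_density (hf : ContinuousOn f (Icc A B)) :
    AEMeasurable (fun y => ENNReal.ofReal (f y)) (volume.restrict (Ioc A B)) :=
  ((hf.mono Ioc_subset_Icc_self).aemeasurable measurableSet_Ioc).ennreal_ofReal

lemma integral_densityWithAtom (hAB : A ≤ B) (hf : ContinuousOn f (Icc A B))
    (hf0 : ∀ y ∈ Icc A B, 0 ≤ f y) (hα : 0 ≤ α) {φ : ℝ → ℝ}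
    (hφ : Integrable φ (densityWithAtom f A B α)) :
    ∫ y, φ y ∂(densityWithAtom f A B α) = (∫ y in A..B, f y * φ y) + α * φ B := by
  unfold densityWithAtom at *
  rw [integral_add_measure hφ.left_of_add_measure hφ.right_of_add_measure, integral_smul_measure,
    integral_dirac, ENNReal.toReal_ofReal hα, smul_eq_mul,
    integral_withDensity_eq_integral_toReal_smul₀ (aemeasurable_density hf)
      (Eventually.of_forall fun _ => ENNReal.ofReal_lt_top),
    intervalIntegral.integral_of_le hAB]
  congr 1
  refine setIntegral_congr_fun measurableSet_Ioc fun y hy => ?_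
  simp only [ENNReal.toReal_ofReal (hf0 y ⟨hy.1.le, hy.2⟩), smul_eq_mul]

lemma isFiniteMeasure_densityWithAtom (hf : ContinuousOn f (Icc A B)) :
    IsFiniteMeasure (densityWithAtom f A B α) := by
  have h1 : IntegrableOn f (Ioc A B) := hf.integrableOn_Icc.mono_set Ioc_subset_Icc_self
  have : IsFiniteMeasure ((volume.restrict (Ioc A B)).withDensity
      (fun y => ENNReal.ofReal (f y))) := isFiniteMeasure_withDensity_ofReal h1.2
  have : IsFiniteMeasure (ENNReal.ofReal α • Measure.dirac B) :=
    Measure.smul_finite _ ENNReal.ofReal_ne_top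
  unfold densityWithAtom
  infer_instance

lemma real_densityWithAtom (hAB : A ≤ B) (hf : ContinuousOn f (Icc A B))
    (hf0 : ∀ y ∈ Icc A B, 0 ≤ f y) (hα : 0 ≤ α) {s : Set ℝ} (hs : MeasurableSet s) :
    (densityWithAtom f A B α).real s
      = (∫ y in Ioc A B ∩ s, f y) + α * s.indicator (fun _ => 1) B := by
  have := isFiniteMeasure_densityWithAtom (α := α) hf
  have h1 := integral_densityWithAtom hAB hf hf0 hα
    (φ := s.indicator fun _ => (1 : ℝ)) ((integrable_const 1).indicator hs)
  rw [integral_indicator hs, setIntegral_const, smul_eq_mul, mul_one] at h1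
  rw [h1, intervalIntegral.integral_of_le hAB, ← setIntegral_indicator hs]
  congr 2
  ext y
  by_cases hy : y ∈ s <;> simp [hy]

lemma densityWithAtom_compl_Icc (hAB : A ≤ B) : densityWithAtom f A B α (Icc A B)ᶜ = 0 := by
  have h1 : (volume.restrict (Ioc A B)) (Icc A B)ᶜ = 0 := by
    rw [Measure.restrict_apply measurableSet_Icc.compl]
    convert measure_empty (μ := (volume : Measure ℝ)) using 2
    ext y
    simp only [mem_inter_iff, mem_compl_iff, mem_Icc, mem_Ioc, mem_empty_iff_false, iff_false]
    grind
  unfold densityWithAtom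
  rw [Measure.add_apply, withDensity_absolutelyContinuous _ _ h1, Measure.smul_apply,
    Measure.dirac_apply' _ measurableSet_Icc.compl]
  simp [hAB]

/-- The density is positive, so Lebesgue measure on the interval is absolutely continuous with
respect to the law; interior points therefore lie in the support. -/
lemma support_densityWithAtom (hAB : A < B) (hf : ContinuousOn f (Icc A B))
    (hf0 : ∀ y ∈ Icc A B, 0 < f y) : (densityWithAtom f A B α).support = Icc A B := by
  refine Subset.antisymm
    (Measure.support_subset_of_isClosed isClosed_Icc (densityWithAtom_compl_Icc hAB.le)) ?_
  rw [← closure_Ioo hAB.ne]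
  refine closure_minimal (fun x hx => ?_) Measure.isClosed_support
  rw [Measure.mem_support_iff_forall]
  intro U hU
  rw [pos_iff_ne_zero]
  intro h0
  unfold densityWithAtom at h0
  rw [Measure.add_apply, add_eq_zero] at h0
  have h1 : volume.restrict (Ioc A B) ≪ (volume.restrict (Ioc A B)).withDensity
      (fun y => ENNReal.ofReal (f y)) := by
    refine withDensity_absolutelyContinuous' (aemeasurable_density hf) ?_
    filter_upwards [ae_restrict_mem measurableSet_Ioc] with y hy
    rw [ne_eq, ENNReal.ofReal_eq_zero, not_le]
    exact hf0 y ⟨hy.1.le, hy.2⟩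
  have h2 := h1 h0.1
  rw [Measure.restrict_apply' measurableSet_Ioc] at h2
  exact (Measure.measure_pos_of_mem_nhds volume (inter_mem hU (Ioc_mem_nhds hx.1 hx.2))).ne' h2

lemma densityWithAtom_singleton_pos (hα : 0 < α) : 0 < densityWithAtom f A B α {B} := by
  unfold densityWithAtom
  rw [Measure.add_apply, Measure.smul_apply]
  simp [hα]

lemma densityWithAtom_zero_singleton (p : ℝ) : densityWithAtom f A B 0 {p} = 0 := by
  have h1 : (volume.restrict (Ioc A B)) {p} = 0 := by simp
  unfold densityWithAtom
  rw [Measure.add_apply, withDensity_absolutelyContinuous _ _ h1]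
  simp

lemma real_densityWithAtom_Iic (hAB : A ≤ B) (hf : ContinuousOn f (Icc A B))
    (hf0 : ∀ y ∈ Icc A B, 0 ≤ f y) (hα : 0 ≤ α) (hF : ∀ y ∈ Icc A B, HasDerivAt F (f y) y)
    (hFA : F A = 0) (hFB : F B + α = 1) (p : ℝ) :
    (densityWithAtom f A B α).real (Iic p) = if p < A then 0 else if p < B then F p else 1 := by
  have hftc : ∀ q ∈ Icc A B, ∫ y in A..q, f y = F q := by
    intro q hq
    rw [intervalIntegral.integral_eq_sub_of_hasDerivAt (f := F), hFA, sub_zero]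
    · rw [uIcc_of_le hq.1]
      exact fun y hy => hF y ⟨hy.1, hy.2.trans hq.2⟩
    · refine (hf.mono ?_).intervalIntegrable
      rw [uIcc_of_le hq.1]
      exact Icc_subset_Icc_right hq.2
  rw [real_densityWithAtom hAB hf hf0 hα measurableSet_Iic, Ioc_inter_Iic]
  split_ifs with h1 h2
  · rw [Ioc_eq_empty (by simp [h1.le]), indicator_of_notMem (by simp; linarith)]
    simp
  · have h1 := not_lt.mp h1
    rw [min_eq_right h2.le, ← intervalIntegral.integral_of_le h1, hftc p ⟨h1, h2.le⟩,
      indicator_of_notMem (by simpa using h2)]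
    simp
  · have h2 := not_lt.mp h2
    rw [min_eq_left h2, ← intervalIntegral.integral_of_le hAB, hftc B ⟨hAB, le_rfl⟩,
      indicator_of_mem (by simpa using h2), mul_one, hFB]

lemma isProbabilityMeasure_densityWithAtom (hAB : A ≤ B) (hf : ContinuousOn f (Icc A B))
    (hf0 : ∀ y ∈ Icc A B, 0 ≤ f y) (hα : 0 ≤ α) (hF : ∀ y ∈ Icc A B, HasDerivAt F (f y) y)
    (hFA : F A = 0) (hFB : F B + α = 1) :
    IsProbabilityMeasure (densityWithAtom f A B α) := by
  have := isFiniteMeasure_densityWithAtom (α := α) hf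
  have h1 := real_densityWithAtom_Iic hAB hf hf0 hα hF hFA hFB B
  rw [if_neg (by linarith), if_neg (lt_irrefl _)] at h1
  have h2 : (densityWithAtom f A B α).real univ = 1 := by
    rw [← h1]
    have h3 : (densityWithAtom f A B α) (Iic B)ᶜ = 0 :=
      measure_mono_null (compl_subset_compl.mpr fun y hy => hy.2) (densityWithAtom_compl_Icc hAB)
    have h4 := measureReal_compl (μ := densityWithAtom f A B α) (measurableSet_Iic (a := B))
    rw [measureReal_def, h3] at h4
    simp at h4
    linarith
  refine ⟨?_⟩
  rw [← ENNReal.ofReal_toReal (measure_ne_top (densityWithAtom f A B α) univ),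
    ← measureReal_def, h2, ENNReal.ofReal_one]

lemma cdf_densityWithAtom (hAB : A ≤ B) (hf : ContinuousOn f (Icc A B))
    (hf0 : ∀ y ∈ Icc A B, 0 ≤ f y) (hα : 0 ≤ α) (hF : ∀ y ∈ Icc A B, HasDerivAt F (f y) y)
    (hFA : F A = 0) (hFB : F B + α = 1) (p : ℝ) :
    ProbabilityTheory.cdf (densityWithAtom f A B α) p
      = if p < A then 0 else if p < B then F p else 1 := by
  have := isProbabilityMeasure_densityWithAtom hAB hf hf0 hα hF hFA hFB
  rw [ProbabilityTheory.cdf_eq_real]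
  exact real_densityWithAtom_Iic hAB hf hf0 hα hF hFA hFB p

lemma isMixedStrategy_densityWithAtom (hA : 0 ≤ A) (hAB : A ≤ B) (hf : ContinuousOn f (Icc A B))
    (hf0 : ∀ y ∈ Icc A B, 0 ≤ f y) (hα : 0 ≤ α) (hF : ∀ y ∈ Icc A B, HasDerivAt F (f y) y)
    (hFA : F A = 0) (hFB : F B + α = 1) : IsMixedStrategy (densityWithAtom f A B α) := by
  refine ⟨isProbabilityMeasure_densityWithAtom hAB hf hf0 hα hF hFA hFB, ?_⟩
  refine measure_mono_null (t := (Icc A B)ᶜ) (fun y hy h => ?_) (densityWithAtom_compl_Icc hAB)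
  have h1 : y < 0 := hy
  linarith [h.1]

end DensityWithAtom

/-! ### Payoffs against a distribution with a density and an atom -/

lemma measurable_informedDemand (z p z' : ℝ) :
    Measurable fun y => informedDemand z p z' y := by
  have h1 : Measurable fun y : ℝ × ℝ => share (utility z p y.2) (utility z' y.1 y.2) := by
    refine measurable_share.comp (f := fun y : ℝ × ℝ => (utility z p y.2, utility z' y.1 y.2))
      (Measurable.prodMk ?_ ?_) <;> unfold utility <;> fun_prop
  exact h1.stronglyMeasurable.integral_prod_right'.measurable

lemma norm_informedDemand_le (z p z' y : ℝ) : ‖informedDemand z p z' y‖ ≤ 1 := by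
  rw [norm_of_nonneg (informedDemand_nonneg _ _ _ _)]
  exact informedDemand_le_one _ _ _ _

lemma integrable_informedDemand (z p z' : ℝ) (μ : Measure ℝ) [IsFiniteMeasure μ] :
    Integrable (fun y => informedDemand z p z' y) μ :=
  Integrable.of_bound (measurable_informedDemand z p z').aestronglyMeasurable 1
    (Eventually.of_forall fun _ => norm_informedDemand_le _ _ _ _)

lemma integral_profit (e z p z' : ℝ) (μ : Measure ℝ) [IsProbabilityMeasure μ] :
    ∫ y, profit e z p z' y ∂μ
      = p * (captiveDemand e z p + ∫ y, informedDemand z p z' y ∂μ) := by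
  unfold profit
  rw [integral_const_mul, integral_add (integrable_const _) (integrable_informedDemand _ _ _ _),
    integral_const, probReal_univ, one_smul]

section Density

variable {f φ ψ Φ : ℝ → ℝ} {A B u v : ℝ}

lemma intervalIntegrable_density_mul (hf : ContinuousOn f (Icc A B)) (hφ : Measurable φ)
    (hφ1 : ∀ y, ‖φ y‖ ≤ 1) (hu : u ∈ Icc A B) (hv : v ∈ Icc A B) :
    IntervalIntegrable (fun y => f y * φ y) volume u v := by
  have h1 : IntegrableOn (fun y => f y * φ y) (Icc A B) :=
    Integrable.mul_bdd hf.integrableOn_Icc hφ.aestronglyMeasurable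
      (Eventually.of_forall hφ1)
  exact (h1.mono_set (uIcc_subset_Icc hu hv)).intervalIntegrable

/-- Here φ is a demand, which agrees with a simple ψ only inside one regime; the ends of the
interval are null. -/
lemma integral_density_mul_eq (huv : u ≤ v) (hf : ContinuousOn f (Icc u v))
    (hψ : ContinuousOn ψ (Icc u v)) (hΦ : ∀ y ∈ Icc u v, HasDerivAt Φ (f y * ψ y) y)
    (h : ∀ y ∈ Ioo u v, φ y = ψ y) : ∫ y in u..v, f y * φ y = Φ v - Φ u := by
  rw [← intervalIntegral.integral_eq_sub_of_hasDerivAt (f' := fun y => f y * ψ y)]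
  · refine intervalIntegral.integral_congr_Ioo_of_le huv fun y hy => ?_
    simp only [h y hy]
  · rwa [uIcc_of_le huv]
  · refine ContinuousOn.intervalIntegrable ?_
    rw [uIcc_of_le huv]
    exact hf.mul hψ

lemma integral_density_mul_le (huv : u ≤ v) (hf : ContinuousOn f (Icc u v))
    (hψ : ContinuousOn ψ (Icc u v)) (hΦ : ∀ y ∈ Icc u v, HasDerivAt Φ (f y * ψ y) y)
    (hφ : Measurable φ) (hφ1 : ∀ y, ‖φ y‖ ≤ 1) (hf0 : ∀ y ∈ Icc u v, 0 ≤ f y)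
    (h : ∀ y ∈ Ioo u v, φ y ≤ ψ y) : ∫ y in u..v, f y * φ y ≤ Φ v - Φ u := by
  rw [← integral_density_mul_eq (φ := ψ) huv hf hψ hΦ fun _ _ => rfl]
  refine intervalIntegral.integral_mono_on_of_le_Ioo huv
    (intervalIntegrable_density_mul hf hφ hφ1 (left_mem_Icc.mpr huv) (right_mem_Icc.mpr huv)) ?_
    fun y hy => mul_le_mul_of_nonneg_left (h y hy) (hf0 y (Ioo_subset_Icc_self hy))
  refine ContinuousOn.intervalIntegrable ?_
  rw [uIcc_of_le huv]
  exact hf.mul hψ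

end Density

/-! ### The equilibrium strategies -/

def density₁ (z₁ z₂ c y : ℝ) : ℝ :=
  1 / (2 * (1 - z₂)) * (2 * c / (y + (z₂ - z₁)) ^ 2 - tail z₁ z₂ c y)

def density₂ (z₁ z₂ w y : ℝ) : ℝ :=
  1 / (2 * (1 - z₂)) * (4 * (1 - z₁ - w) / (y - (z₂ - z₁)) ^ 2
    - h z₁ z₂ y (1 - 2 * z₁ + z₂ - w))

def strategy₁ (z₁ z₂ w c α : ℝ) : Measure ℝ :=
  densityWithAtom (density₁ z₁ z₂ c) (1 - z₁ - w) (1 - z₁) α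

def strategy₂ (z₁ z₂ w : ℝ) : Measure ℝ :=
  densityWithAtom (density₂ z₁ z₂ w) (1 - 2 * z₁ + z₂ - w) (1 - 2 * z₁ + z₂) 0

namespace IsParams

variable {z₁ z₂ w c α : ℝ} (hP : IsParams z₁ z₂ w c α)

include hP

lemma low_price_pos : 0 < 1 - z₁ - w := by
  have := hP.half_le; have := hP.lt_bound; have := hP.lt; have := hP.lt_one; have := hP.w_le'
  nlinarith

lemma ceiling_le_c : 1 - 2 * z₁ + z₂ ≤ c := by
  have := hP.half_le; have := hP.le_c
  linarith

lemma hasDerivAt_cdf₁ {y : ℝ} (hy : y ∈ Icc (1 - z₁ - w) (1 - z₁)) :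
    HasDerivAt (fun y => 1 - tail z₁ z₂ c y) (density₁ z₁ z₂ c y) y :=
  ((hP.hasDerivAt_tail y hy).const_sub 1).congr_deriv (by unfold density₁; ring)

lemma hasDerivAt_cdf₂ {y : ℝ} (hy : y ∈ Icc (1 - 2 * z₁ + z₂ - w) (1 - 2 * z₁ + z₂)) :
    HasDerivAt (fun p => h z₁ z₂ p (1 - 2 * z₁ + z₂ - w)) (density₂ z₁ z₂ w y) y :=
  hP.hasDerivAt_h y hy

lemma tail_le_one {y : ℝ} (hy : y ∈ Icc (1 - z₁ - w) (1 - z₁)) : tail z₁ z₂ c y ≤ 1 := by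
  have := hP.half_le; have := hP.lt; have := hP.lt_one; have := hP.low_price_pos
  have := hP.le_c
  refine SpatialCompetition.tail_le_one ?_ ?_ ?_ ?_ hP.hasDerivAt_tail hP.tail_left hy
  · exact one_div_pos.mpr (by linarith)
  all_goals linarith

lemma le_tail {y : ℝ} (hy : y ∈ Icc (1 - z₁ - w) (1 - z₁)) : α ≤ tail z₁ z₂ c y := by
  have := hP.half_le; have := hP.lt; have := hP.lt_one; have := hP.low_price_pos
  have := hP.le_c; have := hP.w_pos
  rw [← hP.tail_right]
  refine SpatialCompetition.tail_antitoneOn (l := 1 / (2 * (1 - z₂))) ?_ ?_ ?_ ?_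
    hP.hasDerivAt_tail hP.tail_left hy ⟨by linarith, le_rfl⟩ hy.2
  · exact one_div_pos.mpr (by linarith)
  all_goals linarith

lemma density₁_pos {y : ℝ} (hy : y ∈ Icc (1 - z₁ - w) (1 - z₁)) : 0 < density₁ z₁ z₂ c y := by
  have := hP.half_le; have := hP.lt; have := hP.lt_one; have := hP.low_price_pos
  have := hP.le_c
  refine tail_density_pos ?_ ?_ ?_ ?_ hP.hasDerivAt_tail hP.tail_left hy
  · exact one_div_pos.mpr (by linarith)
  all_goals linarith

lemma density₂_pos {y : ℝ} (hy : y ∈ Icc (1 - 2 * z₁ + z₂ - w) (1 - 2 * z₁ + z₂)) :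
    0 < density₂ z₁ z₂ w y := by
  have h0 := hP.half_le; have := hP.lt; have := hP.lt_one; have := hP.low_price_pos
  have := hP.w_le'; have := hP.lt_bound
  have e : 1 - z₁ - w = 1 - 2 * z₁ + z₂ - w - (z₂ - z₁) := by ring
  have hH := hP.hasDerivAt_h
  unfold density₂
  rw [e] at hH ⊢
  refine (cdf_eq_le_one (b := 1 - 2 * z₁ + z₂) ?_ ?_ ?_ hH hP.h_right hy).2
  · exact one_div_pos.mpr (by linarith)
  · linarith
  -- From ζ ≤ 1/2. Then 4A ≥ 4 · 0.707 B > B².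
  · have h1 : w ≤ 0.586 * (1 - z₁) * (1 / 2) := by nlinarith
    nlinarith

lemma continuousOn_density₁ : ContinuousOn (density₁ z₁ z₂ c) (Icc (1 - z₁ - w) (1 - z₁)) := by
  have := hP.lt; have := hP.low_price_pos
  have h1 : ContinuousOn (tail z₁ z₂ c) (Icc (1 - z₁ - w) (1 - z₁)) := fun y hy =>
    (hP.hasDerivAt_tail y hy).continuousAt.continuousWithinAt
  unfold density₁
  refine continuousOn_const.mul (ContinuousOn.sub ?_ h1)
  refine ContinuousOn.div (by fun_prop) (by fun_prop) fun y hy => ?_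
  have : 0 < y + (z₂ - z₁) := by linarith [hy.1]
  positivity

lemma continuousOn_density₂ :
    ContinuousOn (density₂ z₁ z₂ w) (Icc (1 - 2 * z₁ + z₂ - w) (1 - 2 * z₁ + z₂)) := by
  have := hP.lt; have := hP.low_price_pos
  have h1 : ContinuousOn (fun p => h z₁ z₂ p (1 - 2 * z₁ + z₂ - w))
      (Icc (1 - 2 * z₁ + z₂ - w) (1 - 2 * z₁ + z₂)) := fun y hy =>
    (hP.hasDerivAt_h y hy).continuousAt.continuousWithinAt
  unfold density₂
  refine continuousOn_const.mul (ContinuousOn.sub ?_ h1)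
  refine ContinuousOn.div (by fun_prop) (by fun_prop) fun y hy => ?_
  have : 0 < y - (z₂ - z₁) := by linarith [hy.1]
  positivity

lemma h_left : h z₁ z₂ (1 - 2 * z₁ + z₂ - w) (1 - 2 * z₁ + z₂ - w) = 0 :=
  h_self (by linarith [hP.low_price_pos])

lemma isMixedStrategy₁ : IsMixedStrategy (strategy₁ z₁ z₂ w c α) :=
  isMixedStrategy_densityWithAtom hP.low_price_pos.le (by linarith [hP.w_pos])
    hP.continuousOn_density₁ (fun _ hy => (hP.density₁_pos hy).le) hP.α_pos.le
    (fun _ hy => hP.hasDerivAt_cdf₁ hy) (by rw [hP.tail_left, sub_self])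
    (by rw [hP.tail_right]; ring)

lemma isMixedStrategy₂ : IsMixedStrategy (strategy₂ z₁ z₂ w) :=
  isMixedStrategy_densityWithAtom (by linarith [hP.low_price_pos, hP.lt]) (by linarith [hP.w_pos])
    hP.continuousOn_density₂ (fun _ hy => (hP.density₂_pos hy).le) le_rfl
    (fun _ hy => hP.hasDerivAt_cdf₂ hy) hP.h_left (by rw [hP.h_right, add_zero])

lemma integral_strategy₁ {φ : ℝ → ℝ} (hφ : Integrable φ (strategy₁ z₁ z₂ w c α)) :
    ∫ y, φ y ∂(strategy₁ z₁ z₂ w c α)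
      = (∫ y in (1 - z₁ - w)..(1 - z₁), density₁ z₁ z₂ c y * φ y) + α * φ (1 - z₁) :=
  integral_densityWithAtom (by linarith [hP.w_pos]) hP.continuousOn_density₁
    (fun _ hy => (hP.density₁_pos hy).le) hP.α_pos.le hφ

lemma integral_strategy₂ {φ : ℝ → ℝ} (hφ : Integrable φ (strategy₂ z₁ z₂ w)) :
    ∫ y, φ y ∂(strategy₂ z₁ z₂ w)
      = ∫ y in (1 - 2 * z₁ + z₂ - w)..(1 - 2 * z₁ + z₂), density₂ z₁ z₂ w y * φ y := by
  have h1 := integral_densityWithAtom (by linarith [hP.w_pos]) hP.continuousOn_density₂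
    (fun _ hy => (hP.density₂_pos hy).le) le_rfl hφ
  rwa [zero_mul, add_zero] at h1

/-- Primitive of an affine function against the distribution of Firm 1. -/
lemma hasDerivAt_primitive₁ (k : ℝ) {y : ℝ} (hy : y ∈ Icc (1 - z₁ - w) (1 - z₁)) :
    HasDerivAt (fun y => -(k - (1 - z₂) + y / 2) * tail z₁ z₂ c y - c / (y + (z₂ - z₁)))
      (density₁ z₁ z₂ c y * (k + y / 2)) y := by
  have := hP.lt; have := hP.low_price_pos
  have h2 : 1 - z₂ ≠ 0 := by linarith [hP.lt_one]
  have h3 : y + (z₂ - z₁) ≠ 0 := by linarith [hy.1]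
  refine ((((hasDerivAt_id' y).div_const 2).const_add (k - (1 - z₂))).neg.mul
    (hP.hasDerivAt_tail y hy)).sub ((hasDerivAt_const y c).div
      ((hasDerivAt_id' y).add_const (z₂ - z₁)) h3) |>.congr_deriv ?_
  simp only [density₁, Pi.neg_apply]
  generalize tail z₁ z₂ c y = X
  generalize y + (z₂ - z₁) = v at *
  field_simp
  ring

/-- Primitive of an affine function against the distribution of Firm 2. -/
lemma hasDerivAt_primitive₂ (k : ℝ) {y : ℝ}
    (hy : y ∈ Icc (1 - 2 * z₁ + z₂ - w) (1 - 2 * z₁ + z₂)) :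
    HasDerivAt (fun y => (k + (1 - z₂) + y / 2) * h z₁ z₂ y (1 - 2 * z₁ + z₂ - w)
      + 2 * (1 - z₁ - w) / (y - (z₂ - z₁))) (density₂ z₁ z₂ w y * (k + y / 2)) y := by
  have := hP.lt; have := hP.low_price_pos
  have h2 : 1 - z₂ ≠ 0 := by linarith [hP.lt_one]
  have h3 : y - (z₂ - z₁) ≠ 0 := by linarith [hy.1]
  refine ((((hasDerivAt_id' y).div_const 2).const_add (k + (1 - z₂))).mul
    (hP.hasDerivAt_h y hy)).add ((hasDerivAt_const y (2 * (1 - z₁ - w))).div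
      ((hasDerivAt_id' y).sub_const (z₂ - z₁)) h3) |>.congr_deriv ?_
  simp only [density₂]
  generalize h z₁ z₂ y (1 - 2 * z₁ + z₂ - w) = X
  generalize y - (z₂ - z₁) = v at *
  field_simp
  ring

end IsParams

/-! ### Payoffs in equilibrium -/

namespace IsParams

variable {z₁ z₂ w c α : ℝ} (hP : IsParams z₁ z₂ w c α)

include hP

/-- At y = p + d the coefficient of H in the primitive equals 1. Sharing contributes H(p + d) + 2A/p
- 2 and undercutting 1 - H(p + d); with the captives, demand is 2A/p. -/
lemma payoff₁_eq {p : ℝ} (hp : p ∈ Icc (1 - z₁ - w) (1 - z₁)) :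
    ∫ y, profit₁ z₁ z₂ p y ∂(strategy₂ z₁ z₂ w) = 2 * (1 - z₁ - w) := by
  have h0 := hP.half_le; have hz := hP.lt; have hz2 := hP.lt_one; have hA := hP.low_price_pos
  have hw := hP.w_pos; have hw' := hP.w_le
  have hpr := hP.isMixedStrategy₂.1
  have hlo : 1 - 2 * z₁ + z₂ - w ≤ p + (z₂ - z₁) := by linarith [hp.1]
  have hhi : p + (z₂ - z₁) ≤ 1 - 2 * z₁ + z₂ := by linarith [hp.2]
  have hx : p + (z₂ - z₁) ∈ Icc (1 - 2 * z₁ + z₂ - w) (1 - 2 * z₁ + z₂) := ⟨hlo, hhi⟩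
  have hs1 : Icc (1 - 2 * z₁ + z₂ - w) (p + (z₂ - z₁)) ⊆ _ := Icc_subset_Icc_right hhi
  have hs2 : Icc (p + (z₂ - z₁)) (1 - 2 * z₁ + z₂) ⊆ _ := Icc_subset_Icc_left hlo
  have hm := measurable_informedDemand z₁ p z₂
  have h1 := norm_informedDemand_le z₁ p z₂
  have hab : 1 - 2 * z₁ + z₂ - w ≤ 1 - 2 * z₁ + z₂ := by linarith
  -- By w ≤ 2d, Firm 2's prices y > a exceed p - d, so Firm 1 is never undercut.
  have e1 := integral_density_mul_eq (φ := fun y => informedDemand z₁ p z₂ y)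
    (ψ := fun y => (z₁ + z₂ - p) / 2 + y / 2) hlo
    (hP.continuousOn_density₂.mono hs1) (by fun_prop)
    (fun y hy => hP.hasDerivAt_primitive₂ ((z₁ + z₂ - p) / 2) (hs1 hy)) (fun y hy => by
      rw [informedDemand₁_eq h0 hz hz2 hp.2 (by linarith [hy.1, hp.2]) hy.2]; ring)
  have e2 := integral_density_mul_eq (φ := fun y => informedDemand z₁ p z₂ y)
    (ψ := fun _ => 1) hhi
    (hP.continuousOn_density₂.mono hs2) (by fun_prop)
    (fun y hy => (hP.hasDerivAt_cdf₂ (hs2 hy)).congr_deriv (mul_one _).symm) (fun y hy => by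
      rw [informedDemand₁_eq_one h0 hz hp.2 hy.1])
  have e3 := hP.integral_strategy₂ (integrable_informedDemand z₁ p z₂ (strategy₂ z₁ z₂ w))
  rw [← intervalIntegral.integral_add_adjacent_intervals
    (intervalIntegrable_density_mul hP.continuousOn_density₂ hm h1 ⟨le_rfl, hab⟩ hx)
    (intervalIntegrable_density_mul hP.continuousOn_density₂ hm h1 hx ⟨hab, le_rfl⟩),
    e1, e2, hP.h_left, hP.h_right] at e3
  unfold profit₁
  rw [integral_profit, captiveDemand₁ (by linarith), if_pos hp.2, e3]
  have e4 : 1 - 2 * z₁ + z₂ - w - (z₂ - z₁) = 1 - z₁ - w := by ring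
  have e5 : p + (z₂ - z₁) - (z₂ - z₁) = p := by ring
  have hp0 : p ≠ 0 := by linarith [hp.1]
  have hA' := hA.ne'
  rw [e4, e5, mul_div_assoc 2 (1 - z₁ - w) (1 - z₁ - w), div_self hA']
  field_simp
  ring

lemma ae_mem_Icc₂ : ∀ᵐ y ∂(strategy₂ z₁ z₂ w),
    y ∈ Icc (1 - 2 * z₁ + z₂ - w) (1 - 2 * z₁ + z₂) :=
  densityWithAtom_compl_Icc (by linarith [hP.w_pos])

lemma ae_mem_Icc₁ : ∀ᵐ y ∂(strategy₁ z₁ z₂ w c α), y ∈ Icc (1 - z₁ - w) (1 - z₁) :=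
  densityWithAtom_compl_Icc (by linarith [hP.w_pos])

omit hP in
lemma integral_informedDemand_le_one (z p z' : ℝ) (μ : Measure ℝ) [IsProbabilityMeasure μ] :
    ∫ y, informedDemand z p z' y ∂μ ≤ 1 := by
  have h1 := integral_mono (integrable_informedDemand z p z' μ) (integrable_const (1 : ℝ))
    fun y => informedDemand_le_one z p z' y
  simpa using h1

lemma payoff₁_le {p : ℝ} (hp : 0 ≤ p) :
    ∫ y, profit₁ z₁ z₂ p y ∂(strategy₂ z₁ z₂ w) ≤ 2 * (1 - z₁ - w) := by
  have h0 := hP.half_le; have hz := hP.lt; have hz2 := hP.lt_one; have hA := hP.low_price_pos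
  have hw := hP.w_pos; have hw' := hP.w_le'; have hlt := hP.lt_bound
  have hpr := hP.isMixedStrategy₂.1
  by_cases h1 : p < 1 - z₁ - w
  · unfold profit₁
    rw [integral_profit]
    have h2 := captiveDemand_le_one 0 z₁ p
    have h3 := integral_informedDemand_le_one z₁ p z₂ (strategy₂ z₁ z₂ w)
    nlinarith
  by_cases h2 : p ≤ 1 - z₁
  · exact (hP.payoff₁_eq ⟨not_lt.mp h1, h2⟩).le
  have h2 := not_le.mp h2
  unfold profit₁
  rw [integral_profit, captiveDemand₁ (by linarith), if_neg h2.not_ge, zero_add]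
  have h3 : ∫ y, informedDemand z₁ p z₂ y ∂(strategy₂ z₁ z₂ w)
      ≤ max (z₂ - 3 / 2 * (p - (1 - z₁))) 0 := by
    have h4 : ∫ y, informedDemand z₁ p z₂ y ∂(strategy₂ z₁ z₂ w)
        ≤ ∫ _, max (z₂ - 3 / 2 * (p - (1 - z₁))) 0 ∂(strategy₂ z₁ z₂ w) := by
      refine integral_mono_ae (integrable_informedDemand z₁ p z₂ _) (integrable_const _) ?_
      filter_upwards [hP.ae_mem_Icc₂] with y hy
      refine (informedDemand₁_le hz (by linarith [hy.2])).trans (max_le_max ?_ le_rfl)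
      linarith [le_max_right 0 (p + z₁ - 1), hy.2]
    simpa using h4
  refine (mul_le_mul_of_nonneg_left h3 hp).trans ?_
  have h5 : w ≤ 0.293 * (1 - z₁) := by nlinarith
  rcases max_cases (z₂ - 3 / 2 * (p - (1 - z₁))) 0 with h4 | h4
  · rw [h4.1]
    have h6 : w ≤ 0.586 * ((1 - z₁) * (1 - z₂)) := by linarith
    obtain ⟨s, rfl⟩ : ∃ s, p = 1 - z₁ + s := ⟨p - (1 - z₁), by ring⟩
    have hs : 0 < s := by linarith
    -- The slope is below 1 - 1.5 · 0.414 = 0.379 < 3 · 0.129, and 1.5 · 0.129² < 0.025.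
    have h7 : (z₂ - 3 / 2 * (1 - z₁)) * s - 3 / 2 * s ^ 2 ≤ 0.025 := by nlinarith [sq_nonneg (s - 0.129)]
    have h8 : 0.025 ≤ (1 - z₁) * (2 - z₂) - 1.172 * ((1 - z₁) * (1 - z₂)) := by nlinarith
    linarith
  · rw [h4.1]
    linarith

/-! ### Firm 2: prices that undercut part of Firm 1's support -/

/-- The total demand of Firm 2 at a price `p` at which it undercuts the prices of Firm 1
above `q = p + (z₂ - z₁)`. -/
def undercutDemand (z₁ z₂ w c q : ℝ) : ℝ :=
  1 + (1 - (z₂ - z₁)) * tail z₁ z₂ c q + (z₂ - z₁) - (q - (1 - z₁ - w)) / 2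
    + c / (1 - 2 * z₁ + z₂ - w) - c / (q + (z₂ - z₁))

lemma hasDerivAt_undercutDemand {q : ℝ} (hq : q ∈ Icc (1 - z₁ - w) (1 - z₁)) :
    HasDerivAt (undercutDemand z₁ z₂ w c)
      (-z₁ * density₁ z₁ z₂ c q - (1 - tail z₁ z₂ c q) / 2) q := by
  have := hP.lt; have := hP.low_price_pos
  have h2 : 1 - z₂ ≠ 0 := by linarith [hP.lt_one]
  have h3 : q + (z₂ - z₁) ≠ 0 := by linarith [hq.1]
  refine ((((((hP.hasDerivAt_tail q hq).const_mul (1 - (z₂ - z₁))).const_add 1).add_const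
    (z₂ - z₁)).sub (((hasDerivAt_id' q).sub_const (1 - z₁ - w)).div_const 2)).add_const
    (c / (1 - 2 * z₁ + z₂ - w))).sub ((hasDerivAt_const q c).div
      ((hasDerivAt_id' q).add_const (z₂ - z₁)) h3) |>.congr_deriv ?_
  simp only [density₁]
  generalize tail z₁ z₂ c q = X
  generalize q + (z₂ - z₁) = v at *
  field_simp
  ring

/-- Demand equals 2 at q = A. Adding (z₁ + (q - A)/2)(1 - T) absorbs its negative derivative and
leaves (q - A)/2 times the density. -/
lemma le_undercutDemand {q : ℝ} (hq : q ∈ Icc (1 - z₁ - w) (1 - z₁)) :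
    2 - (z₁ + w / 2) * (1 - tail z₁ z₂ c q) ≤ undercutDemand z₁ z₂ w c q := by
  have e0 : undercutDemand z₁ z₂ w c (1 - z₁ - w) = 2 := by
    have e : 1 - z₁ - w + (z₂ - z₁) = 1 - 2 * z₁ + z₂ - w := by ring
    unfold undercutDemand
    rw [hP.tail_left, e]
    ring
  have h1 := le_of_hasDerivAt_nonneg (f := fun q => undercutDemand z₁ z₂ w c q
      + (z₁ + (q - (1 - z₁ - w)) / 2) * (1 - tail z₁ z₂ c q))
    (f' := fun q => (q - (1 - z₁ - w)) / 2 * density₁ z₁ z₂ c q) hq.1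
    (fun t ht => by
      have ht' : t ∈ Icc (1 - z₁ - w) (1 - z₁) := ⟨ht.1, ht.2.trans hq.2⟩
      refine ((hP.hasDerivAt_undercutDemand ht').add
        (((((hasDerivAt_id' t).sub_const (1 - z₁ - w)).div_const 2).const_add z₁).mul
          (hP.hasDerivAt_cdf₁ ht'))).congr_deriv ?_
      ring)
    (fun t ht => mul_nonneg (by linarith [ht.1])
      (hP.density₁_pos ⟨ht.1, ht.2.trans hq.2⟩).le)
  simp only [e0, hP.tail_left] at h1
  have h2 := hP.tail_le_one hq
  nlinarith [hq.2]

/-- Let Q = (1 + ζα)/b. As c/(t + d)² ≥ Q and T ≤ 1, the density is at least l(2Q - 1); integrate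
down from B, where 1 - T = 1 - α. -/
lemma cdf₁_le {q : ℝ} (hq : q ∈ Icc (1 - z₁ - w) (1 - z₁)) :
    1 - tail z₁ z₂ c q ≤ 1 - α - 1 / (2 * (1 - z₂)) *
      (2 * ((1 + (1 - z₂) * α) / (1 - 2 * z₁ + z₂)) - 1) * (1 - z₁ - q) := by
  have h0 := hP.half_le; have hz := hP.lt; have hz2 := hP.lt_one; have hA := hP.low_price_pos
  have hb : 0 < 1 - 2 * z₁ + z₂ := by linarith
  have hα := hP.α_pos
  have h1 := le_of_hasDerivAt_nonneg (f := fun t => 1 - tail z₁ z₂ c t - 1 / (2 * (1 - z₂)) *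
      (2 * ((1 + (1 - z₂) * α) / (1 - 2 * z₁ + z₂)) - 1) * t) hq.2
    (fun t ht => (hP.hasDerivAt_cdf₁ ⟨hq.1.trans ht.1, ht.2⟩).sub
      ((hasDerivAt_id' t).const_mul _))
    (fun t ht => by
      have h2 := hP.tail_le_one ⟨hq.1.trans ht.1, ht.2⟩
      have h3 : 0 < t + (z₂ - z₁) := by linarith [hq.1, ht.1]
      have h4 : (1 + (1 - z₂) * α) / (1 - 2 * z₁ + z₂) ≤ c / (t + (z₂ - z₁)) ^ 2 := by
        have h5 : 0 ≤ 1 + (1 - z₂) * α := by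
          have := mul_nonneg (by linarith : 0 ≤ 1 - z₂) hα.le
          linarith
        rw [hP.c_eq, div_le_div_iff₀ hb (by positivity), mul_comm (1 - 2 * z₁ + z₂), mul_assoc]
        refine mul_le_mul_of_nonneg_left ?_ h5
        nlinarith [ht.2]
      have h6 : 2 * c / (t + (z₂ - z₁)) ^ 2 = 2 * (c / (t + (z₂ - z₁)) ^ 2) := by ring
      unfold density₁
      rw [mul_one, ← mul_sub, h6]
      refine mul_nonneg (one_div_nonneg.mpr (by linarith)) ?_
      linarith)
  simp only [hP.tail_right] at h1
  linarith

/-- With P = 1 + ζα and κ = z₁ + ζ/2 + w/2, the derivative is at least 2 - κ(1 - T) - z₁P/(q + d).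
Let r = (B - q)/ζ. Compared with q = B, the bound for the last term grows by z₁Qr, while that for
κ(1 - T) falls by κ(2Q - 1)r/2 ≥ z₁(2Q - 1)r/2. The net loss z₁r/2 is at most z₁w/(2ζ), and
`IsParams.undercut` remains. -/
lemma undercut_deriv_nonneg {q : ℝ} (hq : q ∈ Icc (1 - z₁ - w) (1 - z₁)) :
    0 ≤ undercutDemand z₁ z₂ w c q + (q - (z₂ - z₁)) *
      (-z₁ * density₁ z₁ z₂ c q - (1 - tail z₁ z₂ c q) / 2) := by
  have h0 := hP.half_le; have hz := hP.lt; have hz2 := hP.lt_one; have hA := hP.low_price_pos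
  have hw := hP.w_pos; have hw' := hP.w_le; have hα := hP.α_pos
  have hS := hP.undercut
  have hc := hP.c_eq
  have hD := hP.le_undercutDemand hq
  have hF := hP.cdf₁_le hq
  have hf := hP.density₁_pos hq
  have hT := hP.tail_le_one hq
  have hTα := hP.le_tail hq
  have hqA := hq.1
  have hqB := hq.2
  have hζ : 0 < 1 - z₂ := by linarith
  have hb : 0 < 1 - 2 * z₁ + z₂ := by linarith
  have ht : 0 < (1 - z₂) * α := mul_pos hζ hα
  set P : ℝ := 1 + (1 - z₂) * α with hPdef
  have hP1 : 1 < P := by linarith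
  have hb1 : 1 - 2 * z₁ + z₂ < 1 := by linarith
  have hp : 0 < q + (z₂ - z₁) := by linarith
  have hpb : q + (z₂ - z₁) ≤ 1 - 2 * z₁ + z₂ := by linarith
  have hPb : P ≤ P / (1 - 2 * z₁ + z₂) := by
    rw [le_div_iff₀ hb]
    nlinarith
  -- the undercutting share times the density
  have h1 : (q - (z₂ - z₁)) * density₁ z₁ z₂ c q ≤ P / (q + (z₂ - z₁)) := by
    have h2 : (1 - z₂) * density₁ z₁ z₂ c q ≤ c / (q + (z₂ - z₁)) ^ 2 := by
      have h3 : (1 - z₂) * density₁ z₁ z₂ c q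
          = c / (q + (z₂ - z₁)) ^ 2 - tail z₁ z₂ c q / 2 := by
        unfold density₁
        field_simp
      rw [h3]
      linarith
    -- The ratio (q - d)/(q + d) increases in q and equals ζ/b at q = B.
    have h4 : (q - (z₂ - z₁)) * (1 - 2 * z₁ + z₂) ≤ (q + (z₂ - z₁)) * (1 - z₂) := by nlinarith
    have h5 : (q - (z₂ - z₁)) * density₁ z₁ z₂ c q * (1 - 2 * z₁ + z₂)
        ≤ (q + (z₂ - z₁)) * (c / (q + (z₂ - z₁)) ^ 2) := by
      have h6 := mul_le_mul_of_nonneg_right h4 hf.le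
      have h7 := mul_le_mul_of_nonneg_left h2 hp.le
      linarith
    have h8 : (q + (z₂ - z₁)) * (c / (q + (z₂ - z₁)) ^ 2)
        = P / (q + (z₂ - z₁)) * (1 - 2 * z₁ + z₂) := by
      rw [hc]
      generalize q + (z₂ - z₁) = v at *
      field_simp
    rw [h8] at h5
    exact le_of_mul_le_mul_right h5 hb
  have h2 : (q - (z₂ - z₁)) * ((1 - tail z₁ z₂ c q) / 2)
      ≤ (1 - z₂) * ((1 - tail z₁ z₂ c q) / 2) :=
    mul_le_mul_of_nonneg_right (by linarith) (by linarith)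
  have h3 : P / (q + (z₂ - z₁)) ≤ P / (1 - 2 * z₁ + z₂)
      + P / (1 - 2 * z₁ + z₂) * ((1 - z₁ - q) / (1 - z₂)) := by
    have h4 : P / (q + (z₂ - z₁)) = P / (1 - 2 * z₁ + z₂)
        + P / (1 - 2 * z₁ + z₂) * ((1 - z₁ - q) / (q + (z₂ - z₁))) := by
      have : 1 - z₁ - q = 1 - 2 * z₁ + z₂ - (q + (z₂ - z₁)) := by ring
      rw [this]
      generalize q + (z₂ - z₁) = v at *
      field_simp
      ring
    rw [h4]
    have h5 : (1 - z₁ - q) / (q + (z₂ - z₁)) ≤ (1 - z₁ - q) / (1 - z₂) :=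
      div_le_div_of_nonneg_left (by linarith) hζ (by linarith)
    have h6 : 0 ≤ P / (1 - 2 * z₁ + z₂) := by linarith
    linarith [mul_le_mul_of_nonneg_left h5 h6]
  generalize P / (1 - 2 * z₁ + z₂) = Q at *
  set r : ℝ := (1 - z₁ - q) / (1 - z₂) with hr
  have hr0 : 0 ≤ r := div_nonneg (by linarith) hζ.le
  have hrw : r / 2 ≤ w / (2 * (1 - z₂)) := by
    rw [hr, div_div, mul_comm (1 - z₂)]
    exact div_le_div_of_nonneg_right (by linarith) (by linarith)
  have hF' : 1 - tail z₁ z₂ c q ≤ 1 - α - (2 * Q - 1) * (r / 2) := by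
    refine hF.trans_eq ?_
    rw [hr, ← div_div]
    ring
  have hκ : (z₁ + (1 - z₂) / 2 + w / 2) * (1 - tail z₁ z₂ c q)
      ≤ (z₁ + (1 - z₂) / 2 + w / 2) * (1 - α - (2 * Q - 1) * (r / 2)) :=
    mul_le_mul_of_nonneg_left hF' (by linarith)
  have h7 : z₁ * ((2 * Q - 1) * (r / 2))
      ≤ (z₁ + (1 - z₂) / 2 + w / 2) * ((2 * Q - 1) * (r / 2)) :=
    mul_le_mul_of_nonneg_right (by linarith) (mul_nonneg (by linarith) (by linarith))
  have hz0 : 0 ≤ z₁ := by linarith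
  have h8 := mul_le_mul_of_nonneg_left h1 hz0
  have h9 := mul_le_mul_of_nonneg_left h3 hz0
  have h10 := mul_le_mul_of_nonneg_left hrw hz0
  linarith

lemma undercut_le {q : ℝ} (hq : q ∈ Icc (1 - z₁ - w) (1 - z₁)) :
    (q - (z₂ - z₁)) * undercutDemand z₁ z₂ w c q ≤ c := by
  have h0 := hP.half_le; have hz := hP.lt; have hz2 := hP.lt_one; have hA := hP.low_price_pos
  have h1 := le_of_hasDerivAt_nonneg
    (f := fun q => (q - (z₂ - z₁)) * undercutDemand z₁ z₂ w c q)
    (f' := fun q => undercutDemand z₁ z₂ w c q + (q - (z₂ - z₁)) *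
      (-z₁ * density₁ z₁ z₂ c q - (1 - tail z₁ z₂ c q) / 2)) hq.2
    (fun t ht => (((hasDerivAt_id' t).sub_const (z₂ - z₁)).mul
      (hP.hasDerivAt_undercutDemand ⟨hq.1.trans ht.1, ht.2⟩)).congr_deriv (by ring))
    (fun t ht => hP.undercut_deriv_nonneg ⟨hq.1.trans ht.1, ht.2⟩)
  refine h1.trans ?_
  have h2 := hP.deviation
  have h3 := hP.c_eq
  have e1 : 1 - z₁ + (z₂ - z₁) = 1 - 2 * z₁ + z₂ := by ring
  have hb : 0 < 1 - 2 * z₁ + z₂ := by linarith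
  have e2 : (1 - z₂) * α = c / (1 - 2 * z₁ + z₂) - 1 := by
    rw [h3]; field_simp; ring
  unfold undercutDemand
  rw [hP.tail_right, e1]
  have e3 : (1 - z₁ - (z₂ - z₁)) * (1 + (1 - (z₂ - z₁)) * α + (z₂ - z₁)
      - (1 - z₁ - (1 - z₁ - w)) / 2 + c / (1 - 2 * z₁ + z₂ - w) - c / (1 - 2 * z₁ + z₂))
      = (1 - z₂) * (1 + (z₂ - z₁) - w / 2) + (1 - (z₂ - z₁)) * ((1 - z₂) * α)
        + (1 - z₂) * (c / (1 - 2 * z₁ + z₂ - w)) - (1 - z₂) * (c / (1 - 2 * z₁ + z₂)) := by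
    ring
  have e4 : (z₁ / (1 - 2 * z₁ + z₂) + (1 - z₂) / (1 - 2 * z₁ + z₂ - w) - 1) * c
      = z₁ * (c / (1 - 2 * z₁ + z₂)) + (1 - z₂) * (c / (1 - 2 * z₁ + z₂ - w)) - c := by
    ring
  rw [e4] at h2
  rw [e3, e2]
  linarith

/-- Rival prices below q share the market, as q - A ≤ w ≤ 2d prevents them from undercutting; those
above q, with the atom, contribute at most T(q). -/
lemma integral_informedDemand₂_undercut_le {q : ℝ} (hq : q ∈ Icc (1 - z₁ - w) (1 - z₁)) :
    1 + ∫ y, informedDemand z₂ (q - (z₂ - z₁)) z₁ y ∂(strategy₁ z₁ z₂ w c α)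
      ≤ undercutDemand z₁ z₂ w c q := by
  have hz := hP.lt; have hz2 := hP.lt_one; have hw' := hP.w_le; have hα := hP.α_pos
  have hpr := hP.isMixedStrategy₁.1
  have hs1 : Icc (1 - z₁ - w) q ⊆ _ := Icc_subset_Icc_right hq.2
  have hs2 : Icc q (1 - z₁) ⊆ _ := Icc_subset_Icc_left hq.1
  have hm := measurable_informedDemand z₂ (q - (z₂ - z₁)) z₁
  have h1 := norm_informedDemand_le z₂ (q - (z₂ - z₁)) z₁
  have hAB := hq.1.trans hq.2
  have e1 := integral_density_mul_le (φ := fun y => informedDemand z₂ (q - (z₂ - z₁)) z₁ y)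
    (ψ := fun y => (1 - (q + 2 * z₁) / 2) + y / 2) hq.1
    (hP.continuousOn_density₁.mono hs1) (by fun_prop)
    (fun y hy => hP.hasDerivAt_primitive₁ (1 - (q + 2 * z₁) / 2) (hs1 hy)) hm h1
    (fun y hy => (hP.density₁_pos (hs1 hy)).le) (fun y hy => by
      refine (informedDemand₂_le hz hz2 ?_ ?_).trans_eq ?_
      · linarith [hy.1, hq.2]
      · linarith [hy.2]
      · ring)
  have e2 := integral_density_mul_le (φ := fun y => informedDemand z₂ (q - (z₂ - z₁)) z₁ y)
    (ψ := fun _ => 1) hq.2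
    (hP.continuousOn_density₁.mono hs2) (by fun_prop)
    (fun y hy => (hP.hasDerivAt_cdf₁ (hs2 hy)).congr_deriv (mul_one _).symm) hm h1
    (fun y hy => (hP.density₁_pos (hs2 hy)).le) (fun y _ => informedDemand_le_one _ _ _ _)
  have e3 := hP.integral_strategy₁
    (integrable_informedDemand z₂ (q - (z₂ - z₁)) z₁ (strategy₁ z₁ z₂ w c α))
  rw [← intervalIntegral.integral_add_adjacent_intervals
    (intervalIntegrable_density_mul hP.continuousOn_density₁ hm h1 ⟨le_rfl, hAB⟩ hq)
    (intervalIntegrable_density_mul hP.continuousOn_density₁ hm h1 hq ⟨hAB, le_rfl⟩)] at e3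
  have e4 := mul_le_mul_of_nonneg_left
    (informedDemand_le_one z₂ (q - (z₂ - z₁)) z₁ (1 - z₁)) hα.le
  have e5 : 1 - z₁ - w + (z₂ - z₁) = 1 - 2 * z₁ + z₂ - w := by ring
  rw [hP.tail_left, e5] at e1
  rw [hP.tail_right] at e2
  unfold undercutDemand
  rw [e3]
  linarith

/-! ### Firm 2: prices that do not undercut the atom -/

lemma primitive₁_right (k : ℝ) : -(k - (1 - z₂) + (1 - z₁) / 2) * tail z₁ z₂ c (1 - z₁)
    - c / (1 - z₁ + (z₂ - z₁)) = -(k + (1 - z₁) / 2) * α - 1 := by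
  have hb : 0 < 1 - 2 * z₁ + z₂ := by linarith [hP.low_price_pos, hP.lt, hP.w_pos]
  have e1 : 1 - z₁ + (z₂ - z₁) = 1 - 2 * z₁ + z₂ := by ring
  have e2 : c / (1 - 2 * z₁ + z₂) = 1 + (1 - z₂) * α := by
    have h1 := hP.c_eq
    rw [h1]
    field_simp
  rw [hP.tail_right, e1, e2]
  ring

/-- Here B < p + d and A ≥ p - d, so one affine bound covers all of Firm 1's prices. The atom's own
term cancels the α-term of `primitive₁_right`. -/
lemma integral_informedDemand₂_mid_le {p : ℝ} (hp : 1 - z₂ < p)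
    (hpa : p ≤ 1 - 2 * z₁ + z₂ - w) :
    ∫ y, informedDemand z₂ p z₁ y ∂(strategy₁ z₁ z₂ w c α)
      ≤ c / (1 - 2 * z₁ + z₂ - w) - 1 + (1 - 2 * z₁ + z₂ - w - p) / 2 := by
  have hz := hP.lt; have hz2 := hP.lt_one; have hw := hP.w_pos; have hα := hP.α_pos
  have hpr := hP.isMixedStrategy₁.1
  have hm := measurable_informedDemand z₂ p z₁
  have h1 := norm_informedDemand_le z₂ p z₁
  have hAB : 1 - z₁ - w ≤ 1 - z₁ := by linarith
  have hle : ∀ y ∈ Icc (1 - z₁ - w) (1 - z₁),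
      informedDemand z₂ p z₁ y ≤ (1 - (p + z₁ + z₂) / 2) + y / 2 := fun y hy => by
    refine (informedDemand₂_le hz hz2 ?_ ?_).trans_eq ?_
    · linarith [hy.1]
    · linarith [hy.2]
    · ring
  have e1 := integral_density_mul_le (φ := fun y => informedDemand z₂ p z₁ y)
    (ψ := fun y => (1 - (p + z₁ + z₂) / 2) + y / 2) hAB hP.continuousOn_density₁ (by fun_prop)
    (fun y hy => hP.hasDerivAt_primitive₁ (1 - (p + z₁ + z₂) / 2) hy) hm h1
    (fun y hy => (hP.density₁_pos hy).le) fun y hy => hle y (Ioo_subset_Icc_self hy)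
  have e2 := mul_le_mul_of_nonneg_left (hle (1 - z₁) ⟨hAB, le_rfl⟩) hα.le
  have e5 : 1 - z₁ - w + (z₂ - z₁) = 1 - 2 * z₁ + z₂ - w := by ring
  rw [hP.primitive₁_right, hP.tail_left, e5] at e1
  rw [hP.integral_strategy₁ (integrable_informedDemand z₂ p z₁ (strategy₁ z₁ z₂ w c α))]
  linarith

lemma integral_density₁_of_lt {p : ℝ} (hlo : 1 - 2 * z₁ + z₂ - w ≤ p)
    (hhi : p ≤ 1 - 2 * z₁ + z₂) :
    ∫ y, informedDemand z₂ p z₁ y ∂(strategy₁ z₁ z₂ w c α)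
      = (∫ y in (p - (z₂ - z₁))..(1 - z₁), density₁ z₁ z₂ c y * informedDemand z₂ p z₁ y)
        + α * informedDemand z₂ p z₁ (1 - z₁) := by
  have hpr := hP.isMixedStrategy₁.1
  have hm := measurable_informedDemand z₂ p z₁
  have h1 := norm_informedDemand_le z₂ p z₁
  have hx : p - (z₂ - z₁) ∈ Icc (1 - z₁ - w) (1 - z₁) := ⟨by linarith, by linarith⟩
  have hAB := hx.1.trans hx.2
  have e1 : ∫ y in (1 - z₁ - w)..(p - (z₂ - z₁)),
      density₁ z₁ z₂ c y * informedDemand z₂ p z₁ y = ∫ _ in (1 - z₁ - w)..(p - (z₂ - z₁)), 0 :=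
    intervalIntegral.integral_congr_Ioo_of_le hx.1 fun y hy => by
      simp only [informedDemand₂_eq_zero hy.2 hP.lt, mul_zero]
  rw [hP.integral_strategy₁ (integrable_informedDemand z₂ p z₁ (strategy₁ z₁ z₂ w c α)),
    ← intervalIntegral.integral_add_adjacent_intervals
    (intervalIntegrable_density_mul hP.continuousOn_density₁ hm h1 ⟨le_rfl, hAB⟩ hx)
    (intervalIntegrable_density_mul hP.continuousOn_density₁ hm h1 hx ⟨hAB, le_rfl⟩), e1]
  simp

lemma integral_informedDemand₂_high_le {p : ℝ} (hlo : 1 - 2 * z₁ + z₂ - w ≤ p)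
    (hp : 1 - z₂ < p) (hhi : p ≤ 1 - 2 * z₁ + z₂) :
    ∫ y, informedDemand z₂ p z₁ y ∂(strategy₁ z₁ z₂ w c α) ≤ c / p - 1 := by
  have hz := hP.lt; have hz2 := hP.lt_one; have hα := hP.α_pos
  have hm := measurable_informedDemand z₂ p z₁
  have h1 := norm_informedDemand_le z₂ p z₁
  have hxB : p - (z₂ - z₁) ≤ 1 - z₁ := by linarith
  have hs : Icc (p - (z₂ - z₁)) (1 - z₁) ⊆ Icc (1 - z₁ - w) (1 - z₁) :=
    Icc_subset_Icc_left (by linarith)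
  have hle : ∀ y ∈ Icc (p - (z₂ - z₁)) (1 - z₁),
      informedDemand z₂ p z₁ y ≤ (1 - (p + z₁ + z₂) / 2) + y / 2 := fun y hy => by
    refine (informedDemand₂_le hz hz2 hy.1 ?_).trans_eq ?_
    · linarith [hy.2]
    · ring
  have e1 := integral_density_mul_le (φ := fun y => informedDemand z₂ p z₁ y)
    (ψ := fun y => (1 - (p + z₁ + z₂) / 2) + y / 2) hxB (hP.continuousOn_density₁.mono hs)
    (by fun_prop) (fun y hy => hP.hasDerivAt_primitive₁ (1 - (p + z₁ + z₂) / 2) (hs hy)) hm h1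
    (fun y hy => (hP.density₁_pos (hs hy)).le) fun y hy => hle y (Ioo_subset_Icc_self hy)
  have e2 := mul_le_mul_of_nonneg_left (hle (1 - z₁) ⟨hxB, le_rfl⟩) hα.le
  have e3 : p - (z₂ - z₁) + (z₂ - z₁) = p := by ring
  -- The coefficient of the tail vanishes at the price p - d where Firm 1 starts to undercut.
  have e4 : 1 - (p + z₁ + z₂) / 2 - (1 - z₂) + (p - (z₂ - z₁)) / 2 = 0 := by ring
  rw [hP.primitive₁_right, e3, e4] at e1
  rw [hP.integral_density₁_of_lt hlo hhi]
  linarith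

lemma integral_informedDemand₂_eq {p : ℝ}
    (hp : p ∈ Ioo (1 - 2 * z₁ + z₂ - w) (1 - 2 * z₁ + z₂)) :
    ∫ y, informedDemand z₂ p z₁ y ∂(strategy₁ z₁ z₂ w c α) = c / p - 1 := by
  have h0 := hP.half_le; have hz := hP.lt; have hz2 := hP.lt_one; have hw' := hP.w_le
  have hlo := hp.1
  have hhi := hp.2
  have hxB : p - (z₂ - z₁) ≤ 1 - z₁ := by linarith
  have hs : Icc (p - (z₂ - z₁)) (1 - z₁) ⊆ Icc (1 - z₁ - w) (1 - z₁) :=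
    Icc_subset_Icc_left (by linarith)
  have heq : ∀ y, p - (z₂ - z₁) < y → y ≤ 1 - z₁ →
      informedDemand z₂ p z₁ y = (1 - (p + z₁ + z₂) / 2) + y / 2 := fun y hy hy' => by
    rw [informedDemand₂_eq hz hz2 h0 hy (by linarith) hy']
    ring
  have e1 := integral_density_mul_eq (φ := fun y => informedDemand z₂ p z₁ y)
    (ψ := fun y => (1 - (p + z₁ + z₂) / 2) + y / 2) hxB (hP.continuousOn_density₁.mono hs)
    (by fun_prop) (fun y hy => hP.hasDerivAt_primitive₁ (1 - (p + z₁ + z₂) / 2) (hs hy))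
    fun y hy => heq y hy.1 hy.2.le
  have e3 : p - (z₂ - z₁) + (z₂ - z₁) = p := by ring
  have e4 : 1 - (p + z₁ + z₂) / 2 - (1 - z₂) + (p - (z₂ - z₁)) / 2 = 0 := by ring
  rw [hP.primitive₁_right, e3, e4] at e1
  rw [hP.integral_density₁_of_lt hlo.le hhi.le, e1, heq _ (by linarith) le_rfl]
  ring

/-- The ceiling b is left out because there Firm 1's atom is at p - d, where the consumers beyond z₂
are indifferent. The endpoints are null for Firm 2's law. -/
lemma payoff₂_eq {p : ℝ} (hp : p ∈ Ioo (1 - 2 * z₁ + z₂ - w) (1 - 2 * z₁ + z₂)) :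
    ∫ y, profit₂ z₁ z₂ y p ∂(strategy₁ z₁ z₂ w c α) = c := by
  have hpr := hP.isMixedStrategy₁.1
  have hp0 : p ≠ 0 := by linarith [hP.low_price_pos, hP.lt, hp.1]
  unfold profit₂
  rw [integral_profit, hP.integral_informedDemand₂_eq hp, captiveDemand₂ hP.lt_one.le,
    if_pos (by linarith [hp.2, hP.half_le])]
  field_simp
  ring

lemma payoff₂_le {p : ℝ} (hp : 0 ≤ p) :
    ∫ y, profit₂ z₁ z₂ y p ∂(strategy₁ z₁ z₂ w c α) ≤ c := by
  have h0 := hP.half_le; have hz := hP.lt; have hz2 := hP.lt_one; have hA := hP.low_price_pos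
  have hw := hP.w_pos; have hw' := hP.w_le; have hcz := hP.le_c; have hbc := hP.ceiling_le_c
  have hpr := hP.isMixedStrategy₁.1
  have hcap := captiveDemand_le_one 1 z₂ p
  unfold profit₂
  rw [integral_profit]
  by_cases hζ : p ≤ 1 - z₂
  · by_cases hq : p + (z₂ - z₁) < 1 - z₁ - w
    · have h1 := hP.undercut_le (q := 1 - z₁ - w) ⟨le_rfl, by linarith⟩
      have h2 := hP.le_undercutDemand (q := 1 - z₁ - w) ⟨le_rfl, by linarith⟩
      rw [hP.tail_left, sub_self, mul_zero, sub_zero] at h2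
      have h3 := integral_informedDemand_le_one z₂ p z₁ (strategy₁ z₁ z₂ w c α)
      have h4 : (1 - z₁ - w - (z₂ - z₁)) * 2 ≤ c :=
        (mul_le_mul_of_nonneg_left h2 (by linarith)).trans h1
      have h5 := mul_le_mul_of_nonneg_left (add_le_add hcap h3) hp
      linarith
    · have hq' : p + (z₂ - z₁) ∈ Icc (1 - z₁ - w) (1 - z₁) := ⟨not_lt.mp hq, by linarith⟩
      have h1 := hP.undercut_le hq'
      have h2 := hP.integral_informedDemand₂_undercut_le hq'
      have e : p + (z₂ - z₁) - (z₂ - z₁) = p := by ring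
      rw [e] at h1 h2
      refine (mul_le_mul_of_nonneg_left ?_ hp).trans h1
      linarith
  have hζ := not_le.mp hζ
  by_cases hpa : p ≤ 1 - 2 * z₁ + z₂ - w
  · have h1 := hP.integral_informedDemand₂_mid_le hζ hpa
    have h2 := mul_le_mul_of_nonneg_left (add_le_add hcap h1) hp
    have ha : 0 < 1 - 2 * z₁ + z₂ - w := by linarith
    have h3 : (1 - 2 * z₁ + z₂ - w) * (c / (1 - 2 * z₁ + z₂ - w)) = c := by field_simp
    have h4 : 1 ≤ c / (1 - 2 * z₁ + z₂ - w) := by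
      rw [one_le_div ha]
      linarith
    -- This product is c - p(c/a + (a - p)/2), the gap to the equilibrium profit.
    have h5 := mul_nonneg (by linarith : 0 ≤ 1 - 2 * z₁ + z₂ - w - p)
      (by linarith : 0 ≤ c / (1 - 2 * z₁ + z₂ - w) - p / 2)
    linarith
  have hpa := not_le.mp hpa
  by_cases hpb : p ≤ 1 - 2 * z₁ + z₂
  · have h1 := hP.integral_informedDemand₂_high_le hpa.le hζ hpb
    have h2 := mul_le_mul_of_nonneg_left (add_le_add hcap h1) hp
    have h3 : p * (c / p) = c := by
      have : p ≠ 0 := by linarith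
      field_simp
    linarith
  have hpb := not_le.mp hpb
  -- Above b Firm 2 is always undercut; its captives buy only up to z₂ ≤ c.
  have h1 : ∫ y, informedDemand z₂ p z₁ y ∂(strategy₁ z₁ z₂ w c α) = 0 := by
    refine integral_eq_zero_of_ae ?_
    filter_upwards [hP.ae_mem_Icc₁] with y hy
    exact informedDemand₂_eq_zero (by linarith [hy.2]) hz
  rw [h1, captiveDemand₂ hz2.le]
  split_ifs <;> linarith

/-! ### The equilibrium -/

lemma expectedProfit₁_le {ν : Measure ℝ} (hν : IsMixedStrategy ν) :
    expectedProfit₁ z₁ z₂ ν (strategy₂ z₁ z₂ w) ≤ 2 * (1 - z₁ - w) := by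
  have := hν.1
  have := hP.isMixedStrategy₂.1
  have hi := integrable_profit₁ z₁ z₂ hν hP.isMixedStrategy₂
  unfold expectedProfit₁
  rw [integral_prod _ hi]
  have h1 : ∀ᵐ p ∂ν, 0 ≤ p := by
    rw [ae_iff]
    simp only [not_le]
    exact hν.2
  refine (integral_mono_ae hi.integral_prod_left (integrable_const (2 * (1 - z₁ - w))) ?_).trans_eq
    (by simp)
  filter_upwards [h1] with p hp
  exact hP.payoff₁_le hp

lemma expectedProfit₁_eq :
    expectedProfit₁ z₁ z₂ (strategy₁ z₁ z₂ w c α) (strategy₂ z₁ z₂ w) = 2 * (1 - z₁ - w) := by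
  have := hP.isMixedStrategy₁.1
  have := hP.isMixedStrategy₂.1
  unfold expectedProfit₁
  rw [integral_prod _ (integrable_profit₁ z₁ z₂ hP.isMixedStrategy₁ hP.isMixedStrategy₂)]
  have h1 : ∀ᵐ p ∂(strategy₁ z₁ z₂ w c α),
      ∫ y, profit₁ z₁ z₂ p y ∂(strategy₂ z₁ z₂ w) = 2 * (1 - z₁ - w) := by
    filter_upwards [hP.ae_mem_Icc₁] with p hp
    exact hP.payoff₁_eq hp
  rw [integral_congr_ae h1]
  simp

lemma expectedProfit₂_le {ν : Measure ℝ} (hν : IsMixedStrategy ν) :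
    expectedProfit₂ z₁ z₂ (strategy₁ z₁ z₂ w c α) ν ≤ c := by
  have := hν.1
  have := hP.isMixedStrategy₁.1
  have hi := integrable_profit₂ z₁ z₂ hP.isMixedStrategy₁ hν
  unfold expectedProfit₂
  rw [integral_prod_symm _ hi]
  have h1 : ∀ᵐ p ∂ν, 0 ≤ p := by
    rw [ae_iff]
    simp only [not_le]
    exact hν.2
  refine (integral_mono_ae hi.integral_prod_right (integrable_const c) ?_).trans_eq (by simp)
  filter_upwards [h1] with p hp
  exact hP.payoff₂_le hp

lemma expectedProfit₂_eq :
    expectedProfit₂ z₁ z₂ (strategy₁ z₁ z₂ w c α) (strategy₂ z₁ z₂ w) = c := by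
  have := hP.isMixedStrategy₁.1
  have := hP.isMixedStrategy₂.1
  unfold expectedProfit₂
  rw [integral_prod_symm _ (integrable_profit₂ z₁ z₂ hP.isMixedStrategy₁ hP.isMixedStrategy₂)]
  have hne : ∀ q : ℝ, ∀ᵐ p ∂(strategy₂ z₁ z₂ w), p ≠ q := fun q => by
    rw [ae_iff]
    simp only [ne_eq, not_not, ofPred_eq_eq_singleton]
    exact densityWithAtom_zero_singleton q
  have h1 : ∀ᵐ p ∂(strategy₂ z₁ z₂ w),
      ∫ y, profit₂ z₁ z₂ y p ∂(strategy₁ z₁ z₂ w c α) = c := by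
    filter_upwards [hP.ae_mem_Icc₂, hne (1 - 2 * z₁ + z₂ - w), hne (1 - 2 * z₁ + z₂)]
      with p hp hpa hpb
    exact hP.payoff₂_eq ⟨lt_of_le_of_ne hp.1 hpa.symm, lt_of_le_of_ne hp.2 hpb⟩
  rw [integral_congr_ae h1]
  simp

theorem isPriceEquilibrium :
    IsPriceEquilibrium z₁ z₂ (strategy₁ z₁ z₂ w c α) (strategy₂ z₁ z₂ w) where
  strategy₁ := hP.isMixedStrategy₁
  strategy₂ := hP.isMixedStrategy₂
  best₁ _ hν := (hP.expectedProfit₁_le hν).trans_eq hP.expectedProfit₁_eq.symm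
  best₂ _ hν := (hP.expectedProfit₂_le hν).trans_eq hP.expectedProfit₂_eq.symm

end IsParams

end SpatialCompetition

end

theorem proposition8 (z₁ z₂ w : ℝ)
    -- the locations lie in the unit interval and in the region of this equilibrium
    (hz₁ : 1 / 2 ≤ z₁) (hz : z₁ < z₂) (hz₂ : z₂ ≤ 1)
    (hregion : (1 - 2 * z₁ + z₂) * (2 - z₂) > z₂)
    -- `w` is a positive root for which the prices in Firm 1's support are positive
    (hw : 0 < w) (hw' : w < 1 - z₁)
    (hroot : h z₁ z₂ (1 - 2 * z₁ + z₂) (1 - 2 * z₁ + z₂ - w) = 1)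
    (hcond_a : z₁ - (1 - z₂) * (z₂ - z₁) + (1 - z₂) * w / 2 ≥
      (z₁ / (1 - 2 * z₁ + z₂) + (1 - z₂) / (1 - 2 * z₁ + z₂ - w) - 1) *
        (g₀ z₁ z₂ (1 - z₁ - w) (1 - z₁) / gPi z₁ z₂ (1 - z₁ - w) (1 - z₁)))
    (hcond_b : g₀ z₁ z₂ (1 - z₁ - w) (1 - z₁) / gPi z₁ z₂ (1 - z₁ - w) (1 - z₁) ≥ z₂) :
    ∃ μ₁ μ₂ : MeasureTheory.Measure ℝ,
      -- the mixed strategies with distribution functions `F₁*` and `F₂*` are an equilibrium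
      (∀ p, ProbabilityTheory.cdf μ₁ p = F₁ z₁ z₂ w p) ∧
      (∀ p, ProbabilityTheory.cdf μ₂ p = F₂ z₁ z₂ w p) ∧
      IsPriceEquilibrium z₁ z₂ μ₁ μ₂ ∧
      -- the profits
      expectedProfit₁ z₁ z₂ μ₁ μ₂ = eqProfit₁ z₁ w ∧
      expectedProfit₂ z₁ z₂ μ₁ μ₂ = eqProfit₂ z₁ z₂ w ∧
      -- the supports, the atom of Firm 1, and the price ceiling of Firm 2
      μ₁.support = Set.Icc (1 - z₁ - w) (1 - z₁) ∧
      μ₂.support = Set.Icc (1 - 2 * z₁ + z₂ - w) (1 - 2 * z₁ + z₂) ∧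
      0 < μ₁ {1 - z₁} ∧
      (∀ p, μ₂ {p} = 0) ∧
      1 - 2 * z₁ + z₂ ≤ z₂ ∧ (1 / 2 < z₁ → 1 - 2 * z₁ + z₂ < z₂) := by
  have hP := isParams hz₁ hz hz₂ hregion hw hw' hroot hcond_a hcond_b
  refine ⟨strategy₁ z₁ z₂ w (eqProfit₂ z₁ z₂ w) (tail z₁ z₂ (eqProfit₂ z₁ z₂ w) (1 - z₁)),
    strategy₂ z₁ z₂ w, fun p => ?_, fun p => ?_, hP.isPriceEquilibrium, hP.expectedProfit₁_eq,
    hP.expectedProfit₂_eq, ?_, ?_, densityWithAtom_singleton_pos hP.α_pos,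
    densityWithAtom_zero_singleton, by linarith, fun h1 => by linarith⟩
  · rw [strategy₁, cdf_densityWithAtom (by linarith) hP.continuousOn_density₁
      (fun _ hy => (hP.density₁_pos hy).le) hP.α_pos.le (fun _ hy => hP.hasDerivAt_cdf₁ hy)
      (by rw [hP.tail_left, sub_self]) (by ring)]
    simp only [F₁, tail, sub_sub_cancel]
  · rw [strategy₂, cdf_densityWithAtom (by linarith) hP.continuousOn_density₂
      (fun _ hy => (hP.density₂_pos hy).le) le_rfl (fun _ hy => hP.hasDerivAt_cdf₂ hy)
      hP.h_left (by rw [hP.h_right, add_zero])]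
    rfl
  · exact support_densityWithAtom (by linarith) hP.continuousOn_density₁
      fun _ hy => hP.density₁_pos hy
  · exact support_densityWithAtom (by linarith) hP.continuousOn_density₂
      fun _ hy => hP.density₂_pos hy
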